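/- Let $d<0$ be a squarefree integer, $F=\mathbb{Q}(\sqrt d)$ with non-trivial automorphism $\bar{\ }$, and let $R\subset F$ be an order (a subring that is a free $\mathbb{Z}$-module of rank $2$). Put $F_2=\mathbb{Q}_2\otimes_{\mathbb{Q}}F$, $R_2=\mathbb{Z}_2\otimes_{\mathbb{Z}}R\subset F_2$, extend $\bar{\ }$ to $F_2$, and let $\mathrm{Nr}(x)=x\bar x$. We say that $R_2$ is maximal if it is the integral closure of $\mathbb{Z}_2$ in $F_2$. Let $(V,h)$ be a non-degenerate hermitian space over $F_2$ (a free $F_2$-module of finite rank, with $h$ linear in the first variable and $h(v,w)=\overline{h(w,v)}$), and let $L\subset V$ be a full $R_2$-lattice, i.e. a finitely generated $R_2$-submodule with $F_2L=V$. Assume that $L$ is a free $R_2$-module of rank $g\ge 2$, that $L$ is unimodular, i.e. $L=\{x\in V: h(x,L)\subseteq R_2\}$, and that $L$ is odd, i.e. $h(x,x)\notin 2\mathbb{Z}_2$ for some $x\in L$. Let $u\in\mathbb{Z}_2^*$ be a representative of $\det(L)\in\mathbb{Z}_2^*/\mathrm{Nr}(R_2^*)$, where $\det(L)$ is the class of the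 determinant of the Gram matrix of an $R_2$-basis of $L$. For $a_1,\dots,a_g\in\mathbb{Z}_2^*$ let $\langle a_1,\dots,a_g\rangle$ be the free hermitian $R_2$-lattice with an orthogonal basis $b_1,\dots,b_g$ such that $h(b_i,b_i)=a_i$; write $L\cong L'$ if some isometry of the ambient hermitian spaces maps $L$ onto $L'$. 1. If $R_2$ is maximal or $3\in\mathrm{Nr}(R_2^*)$ or $7\in\mathrm{Nr}(R_2^*)$, then $L\cong\langle 1,\dots,1,u\rangle$. 2. If none of the conditions in (1) holds and $g>2$, then exactly one of $L\cong\langle 1,\dots,1,u\rangle$ and $L\cong\langle 1,\dots,1,3,3,u\rangle$ holds. 3. If none of the conditions in (1) holds and $g=2$, then exactly one of the following holds: (a) $L\cong\langle 1,u\rangle$; (b) $u\in\mathrm{Nr}(R_2^*)\cup 5\,\mathrm{Nr}(R_2^*)$ and $L\cong\langle 3,3u\rangle$. -/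

import Mathlib

open scoped TensorProduct

noncomputable section

namespace HermLat

/-- The field `F = ℚ(√d)`. -/
abbrev QuadField (d : ℤ) : Type := QuadraticAlgebra ℚ (d : ℚ) 0

/-- The completion `F₂ = ℚ₂ ⊗ F` (a field, or `ℚ₂ × ℚ₂` if `2` splits in `F`). -/
abbrev QuadField₂ (d : ℤ) : Type := ℚ_[2] ⊗[ℚ] QuadField d

/-- `R` is an order in `F`: a subring that is a free `ℤ`-module of rank `2`. -/
structure IsOrder {d : ℤ} (R : Subring (QuadField d)) : Prop where
  free : Module.Free ℤ R
  rank : Module.finrank ℤ R = 2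

/-- The natural map `ℤ₂ ⊗ R → ℚ₂ ⊗ F`. It is injective. -/
def completionMap {d : ℤ} (R : Subring (QuadField d)) :
    ℤ_[2] ⊗[ℤ] R →ₐ[ℤ_[2]] QuadField₂ d :=
  Algebra.TensorProduct.lift (Algebra.ofId ℤ_[2] (QuadField₂ d))
    (((Algebra.TensorProduct.includeRight :
      QuadField d →ₐ[ℚ] QuadField₂ d).toRingHom.comp R.subtype).toIntAlgHom)
    (fun _ _ => Commute.all _ _)

/-- The completion `R₂ = ℤ₂ ⊗ R`, regarded as a subring of `F₂`. -/
def completion₂ {d : ℤ} (R : Subring (QuadField d)) : Subalgebra ℤ_[2] (QuadField₂ d) :=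
  (completionMap R).range

/-- The involution of `F₂` induced by the nontrivial automorphism of `F/ℚ`. -/
def conj₂ (d : ℤ) : QuadField₂ d →+* QuadField₂ d :=
  (Algebra.TensorProduct.map (AlgHom.id ℚ ℚ_[2])
    (starRingEnd (QuadField d)).toRatAlgHom).toRingHom

/-- `S` is the maximal order of `F₂`. -/
def IsMaximalOrder {d : ℤ} (S : Subalgebra ℤ_[2] (QuadField₂ d)) : Prop :=
  S = integralClosure ℤ_[2] (QuadField₂ d)

/-- The norm group `Nr(S*)`, as a set of `2`-adic integers. -/
def normGroup {d : ℤ} (S : Subalgebra ℤ_[2] (QuadField₂ d)) : Set ℤ_[2] :=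
  {a | ∃ r : Sˣ, algebraMap ℤ_[2] (QuadField₂ d) a =
    ((r : S) : QuadField₂ d) * conj₂ d ((r : S) : QuadField₂ d)}

section Lattices

variable {d : ℤ} (S : Subalgebra ℤ_[2] (QuadField₂ d))
variable {V : Type*} [AddCommGroup V] [Module (QuadField₂ d) V]
variable {V' : Type*} [AddCommGroup V'] [Module (QuadField₂ d) V']

/-- Sesquilinear maps, linear in the first and conjugate-linear in the second variable. -/
abbrev SesqForm (d : ℤ) (V : Type*) [AddCommGroup V] [Module (QuadField₂ d) V] : Type _ :=
  V →ₗ[QuadField₂ d] V →ₛₗ[conj₂ d] QuadField₂ d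

/-- `(V, h)` is a (non-degenerate) hermitian space over `F₂`. -/
structure IsHermitianSpace (h : SesqForm d V) : Prop where
  free : Module.Free (QuadField₂ d) V
  finite : Module.Finite (QuadField₂ d) V
  hermitian : ∀ v w, h v w = conj₂ d (h w v)
  nondegenerate : ∀ v, (∀ w, h v w = 0) → v = 0

/-- `L` is a full lattice in `V`: finitely generated, and spanning `V` over `F₂`. -/
structure IsFullLattice (L : Submodule S V) : Prop where
  fg : L.FG
  full : Submodule.span (QuadField₂ d) (L : Set V) = ⊤

/-- The dual lattice `L^# = {x ∈ V | h(x, L) ⊆ S}`. -/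
def dualLattice (h : SesqForm d V) (L : Submodule S V) : Submodule S V where
  carrier := {x | ∀ y ∈ L, h x y ∈ S}
  add_mem' {a b} ha hb y hy := by
    rw [map_add, LinearMap.add_apply]
    exact S.add_mem (ha y hy) (hb y hy)
  zero_mem' y _ := by
    rw [map_zero, LinearMap.zero_apply]
    exact S.zero_mem
  smul_mem' c x hx y hy := by
    have : h (c • x) y = (c : QuadField₂ d) * h x y := by
      rw [Subalgebra.smul_def, map_smul, LinearMap.smul_apply, smul_eq_mul]
    rw [this]
    exact S.mul_mem c.2 (hx y hy)

/-- `L` is unimodular: `L = L^#`. -/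
def IsUnimodular (h : SesqForm d V) (L : Submodule S V) : Prop :=
  L = dualLattice S h L

/-- `L` is even: `h(x, x) ∈ 2ℤ₂` for all `x ∈ L`. -/
def IsEvenLattice (h : SesqForm d V) (L : Submodule S V) : Prop :=
  ∀ x ∈ L, ∃ a : ℤ_[2], h x x = algebraMap ℤ_[2] (QuadField₂ d) (2 * a)

/-- The Gram matrix `(h(b_i, b_j))`. -/
def gram (h : SesqForm d V) {g : ℕ} (b : Fin g → V) : Matrix (Fin g) (Fin g) (QuadField₂ d) :=
  Matrix.of fun i j => h (b i) (b j)

/-- `(V, h) ⊇ L` and `(V', h') ⊇ L'` are isometric lattices. -/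
def Isometric (h : SesqForm d V) (L : Submodule S V)
    (h' : SesqForm d V') (L' : Submodule S V') : Prop :=
  ∃ φ : V ≃ₗ[QuadField₂ d] V', (∀ v w, h' (φ v) (φ w) = h v w) ∧ φ '' (L : Set V) = L'

/-- The form `∑ aᵢ xᵢ ȳᵢ` on `F₂^g`. -/
def diagForm (d : ℤ) {g : ℕ} (a : Fin g → ℤ_[2]) : SesqForm d (Fin g → QuadField₂ d) :=
  LinearMap.mk₂'ₛₗ (RingHom.id _) (conj₂ d)
    (fun x y => ∑ i, algebraMap ℤ_[2] (QuadField₂ d) (a i) * (x i * conj₂ d (y i)))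
    (fun x x' y => by
      rw [← Finset.sum_add_distrib]
      exact Finset.sum_congr rfl fun i _ => by rw [Pi.add_apply]; ring)
    (fun c x y => by
      rw [RingHom.id_apply, smul_eq_mul, Finset.mul_sum]
      exact Finset.sum_congr rfl fun i _ => by rw [Pi.smul_apply, smul_eq_mul]; ring)
    (fun x y y' => by
      rw [← Finset.sum_add_distrib]
      exact Finset.sum_congr rfl fun i _ => by rw [Pi.add_apply, map_add]; ring)
    (fun c x y => by
      rw [smul_eq_mul, Finset.mul_sum]
      exact Finset.sum_congr rfl fun i _ => by rw [Pi.smul_apply, smul_eq_mul, map_mul]; ring)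

/-- The lattice `S^g` in `F₂^g`; with `diagForm d a` it is the lattice `⟨a₁, …, a_g⟩`. -/
def stdLattice (g : ℕ) : Submodule S (Fin g → QuadField₂ d) where
  carrier := {x | ∀ i, x i ∈ S}
  add_mem' ha hb i := S.add_mem (ha i) (hb i)
  zero_mem' _ := S.zero_mem
  smul_mem' c _ hx i := S.mul_mem c.2 (hx i)

/-- `L ≅ ⟨a₁, …, a_g⟩`. -/
def IsometricToDiag (h : SesqForm d V) (L : Submodule S V) {g : ℕ} (a : Fin g → ℤ_[2]) : Prop :=
  Isometric S h L (diagForm d a) (stdLattice S g)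

end Lattices

/-- The tuple `(1, …, 1, u)` of length `g`. -/
def onesThen (g : ℕ) (u : ℤ_[2]) : Fin g → ℤ_[2] :=
  fun i => if (i : ℕ) + 1 = g then u else 1

/-- The tuple `(1, …, 1, 3, 3, u)` of length `g` (for `g ≥ 3`). -/
def onesThenThrees (g : ℕ) (u : ℤ_[2]) : Fin g → ℤ_[2] :=
  fun i => if (i : ℕ) + 1 = g then u else if g ≤ (i : ℕ) + 3 then 3 else 1

end HermLat

end

/-! Write `R₂ = ℤ₂ ⊕ ℤ₂θ` with `θ` of trace `t ∈ {0, 1}` and norm `n`. By `condition_iff`, the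
hypothesis of the first case means `t = 1` or `4 ∤ n`. In the remaining case `t = 0`, `4 ∣ n`, the
norm form is `x² + ny²`, and every norm of a unit is `1` modulo `4`.

An odd unimodular lattice has an orthogonal basis (`exists_hasOrth`), so it is described by a list
of unit lengths. If `⟨a, b⟩` represents a unit `c`, then `⟨a, b⟩ ≅ ⟨c, abc⟩` (`HasOrth.binary`).
Units congruent modulo `8` differ by a square, so which `c` occur is a finite question modulo `8`.
The determinant fixes one length once the others are known (`HasOrth.adjust_det`).

If `t = 1` or `4 ∤ n`, every `⟨a, b⟩` with unit entries represents `1`, and all lengths but one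
become `1`. Otherwise `⟨a, b⟩` represents at least the units congruent to `a` modulo `4`, which
leads to lengths `1` and `3` and one free unit. The identity `HasOrth.quaternary` trades four
lengths that are `3` modulo `4` for four that are `1` modulo `4`, so at rank at least `3` zero or
two entries `3` remain. At rank `2` two entries that are `3` modulo `4` force `u ≡ 1 mod 4`.

The two normal forms are separated by a Gauss sum. If `t = 0` and `4 ∣ n`, then `h(x, x)` modulo `4`
depends only on `x` in `L/(2, θ)L`, a space over `𝔽₂`. The sum of `i ^ h(x, x)` over this space is
an isometry invariant, equal to `∏ (1 + i ^ aⱼ)` for a diagonal lattice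
(`gaussSum_eq_of_isometric`). Two lengths `1` contribute `(1 + i)² = 2i`, two lengths `3` contribute
`(1 - i)² = -2i`. -/

noncomputable section

namespace HermLat

/-! ### Arithmetic of `ℤ₂` modulo `8` -/

/-- Reduction of `2`-adic integers modulo `8`. -/
def red : ℤ_[2] →+* ZMod 8 := PadicInt.toZModPow (p := 2) 3

theorem red_eq_zero_iff (a : ℤ_[2]) : red a = 0 ↔ ∃ b, a = 8 * b := by
  have h1 : red a = 0 ↔ a ∈ RingHom.ker (PadicInt.toZModPow (p := 2) 3) := Iff.rfl
  rw [h1, PadicInt.ker_toZModPow, Ideal.mem_span_singleton]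
  constructor <;> rintro ⟨b, hb⟩ <;> exact ⟨b, by rw [hb]; norm_num⟩

theorem red_surjective : Function.Surjective red := fun c =>
  ⟨(c.val : ℤ_[2]), by rw [map_natCast, ZMod.natCast_zmod_val]⟩

/-- Congruences modulo divisors of `8` are encoded throughout as equations in `ZMod 8`, so that
`decide` applies: `4r = 4` says odd, `4r = 0` even, `2r = 2` and `2r = 6` say `1` and `3` modulo
`4`, and `2r = 0` says divisible by `4`. -/
theorem isUnit_iff_red (a : ℤ_[2]) : IsUnit a ↔ 4 * red a = 4 := by
  constructor
  · intro ha
    have h : ∀ c d : ZMod 8, c * d = 1 → 4 * c = 4 := by decide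
    obtain ⟨b, hb⟩ := ha.exists_right_inv
    exact h _ (red b) (by rw [← map_mul, hb, map_one])
  · intro ha
    by_contra hn
    rw [PadicInt.not_isUnit_iff, PadicInt.norm_lt_one_iff_dvd] at hn
    obtain ⟨b, rfl⟩ := hn
    have h : ∀ c : ZMod 8, 4 * (2 * c) ≠ 4 := by decide
    rw [map_mul, map_natCast] at ha
    exact h _ ha

theorem two_dvd_iff_red (a : ℤ_[2]) : (∃ b, a = 2 * b) ↔ 4 * red a = 0 := by
  constructor
  · rintro ⟨b, rfl⟩
    have h : ∀ c : ZMod 8, 4 * (2 * c) = 0 := by decide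
    rw [map_mul, map_ofNat]
    exact h _
  · intro ha
    have hn : ¬ IsUnit a := by
      rw [isUnit_iff_red, ha]
      decide
    rw [PadicInt.not_isUnit_iff, PadicInt.norm_lt_one_iff_dvd] at hn
    obtain ⟨b, hb⟩ := hn
    exact ⟨b, by simpa using hb⟩

theorem isUnit_or_two_dvd (a : ℤ_[2]) : IsUnit a ∨ ∃ b, a = 2 * b := by
  rw [isUnit_iff_red, two_dvd_iff_red]
  have h : ∀ c : ZMod 8, 4 * c = 4 ∨ 4 * c = 0 := by decide
  exact h _

/-- A `2`-adic integer congruent to `1` modulo `8` is the square of a unit. -/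
theorem exists_sq_of_red_eq_one {a : ℤ_[2]} (ha : red a = 1) : ∃ m : ℤ_[2]ˣ, a = m * m := by
  obtain ⟨b, hb⟩ := (red_eq_zero_iff (a - 1)).1 (by rw [map_sub, ha, map_one, sub_self])
  have h2 : ‖(2 : ℤ_[2])‖ = 1 / 2 := by
    have := PadicInt.norm_p (p := 2)
    push_cast at this
    rw [this]; norm_num
  -- Hensel's lemma applies at `1`: `‖1 - a‖ ≤ 1/8`, which is less than `‖2‖² = 1/4`.
  obtain ⟨z, hz, -⟩ := hensels_lemma (p := 2) (R := ℤ_[2])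
    (F := Polynomial.X ^ 2 - Polynomial.C a) (a := 1) (by
      have : (1 : ℤ_[2]) - a = -(2 ^ 3 * b) := by linear_combination -hb
      simp only [map_sub, map_pow, Polynomial.aeval_X, one_pow, Polynomial.aeval_C,
        Algebra.algebraMap_self, RingHom.id_apply, this, norm_neg, norm_mul, norm_pow, h2,
        Polynomial.derivative_X_pow, Polynomial.derivative_C, sub_zero, map_mul,
        Nat.cast_ofNat, mul_one]
      have := PadicInt.norm_le_one b
      nlinarith [norm_nonneg b])
  have hz' : a = z * z := by
    simp only [map_sub, map_pow, Polynomial.aeval_X, Polynomial.aeval_C,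
        Algebra.algebraMap_self, RingHom.id_apply] at hz
    linear_combination -hz
  have hu : IsUnit a := by
    rw [isUnit_iff_red, ha]
    decide
  have : IsUnit z := isUnit_of_mul_isUnit_left (hz' ▸ hu)
  exact ⟨this.unit, hz'⟩

/-- Units of `ℤ₂` that are congruent modulo `8` differ by the square of a unit. -/
theorem exists_sq_of_red_eq {a c : ℤ_[2]} (hc : IsUnit c) (hac : red a = red c) :
    ∃ m : ℤ_[2]ˣ, a * (m * m) = c := by
  obtain ⟨e, he⟩ := hc.exists_right_inv
  have hr : red a * red e = 1 := by rw [hac, ← map_mul, he, map_one]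
  obtain ⟨m, hm⟩ := exists_sq_of_red_eq_one (a := a * e) (by rw [map_mul, hr])
  have hm1 : (m : ℤ_[2]) * ((m⁻¹ : ℤ_[2]ˣ) : ℤ_[2]) = 1 := by simp
  refine ⟨m⁻¹, ?_⟩
  generalize ((m⁻¹ : ℤ_[2]ˣ) : ℤ_[2]) = k at *
  linear_combination (k * k * c) * hm + (m * k + 1) * c * hm1 - (a * k * k) * he

/-- For trace one the norm form takes every odd value modulo `8`. The factor `1 *` keeps the shape
of `normForm 1 n x y`. -/
theorem exists_norm_mul_eq_one_of_trace_one : ∀ n a : ZMod 8, 4 * a = 4 →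
    ∃ x y : ZMod 8, a * (x * x + 1 * (x * y) + n * (y * y)) = 1 := by
  decide

-- Coordinates in `{0, 1, 2}` suffice because `0, 1, 4` are all the squares modulo `8`; this keeps
-- the search small.
set_option maxRecDepth 10000 in
theorem exists_binary_eq_one_of_not_four_dvd : ∀ n a b : ZMod 8, 2 * n ≠ 0 → 4 * a = 4 →
    4 * b = 4 → ∃ x y z w : Fin 3, a * ((x.val : ZMod 8) * x.val + n * (y.val * y.val)) +
      b * (z.val * z.val + n * (w.val * w.val)) = 1 := by
  decide

/-! ### Quadratic orders over `ℤ₂` -/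

/-- `S = ℤ₂ ⊕ ℤ₂ θ` is a quadratic order, where `θ` has trace `t ∈ {0, 1}` and norm `n`,
and `σ` is the nontrivial automorphism. -/
structure IsQuadOrder {K : Type*} [CommRing K] [Algebra ℤ_[2] K] (σ : K →+* K)
    (S : Subalgebra ℤ_[2] K) (t n : ℤ_[2]) (θ : K) : Prop where
  map_algebraMap : ∀ a, σ (algebraMap ℤ_[2] K a) = algebraMap ℤ_[2] K a
  map_gen : σ θ = algebraMap ℤ_[2] K t - θ
  gen_mul_gen : θ * θ = algebraMap ℤ_[2] K t * θ - algebraMap ℤ_[2] K n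
  mem_iff : ∀ z, z ∈ S ↔ ∃ x y : ℤ_[2], z = algebraMap ℤ_[2] K x + algebraMap ℤ_[2] K y * θ
  indep : ∀ x y : ℤ_[2], algebraMap ℤ_[2] K x + algebraMap ℤ_[2] K y * θ = 0 → x = 0 ∧ y = 0
  trace_eq : t = 0 ∨ t = 1

/-- The norm of `x + yθ`. -/
def normForm (t n x y : ℤ_[2]) : ℤ_[2] := x * x + t * (x * y) + n * (y * y)

namespace IsQuadOrder

variable {K : Type*} [CommRing K] [Algebra ℤ_[2] K] {σ : K →+* K}
  {S : Subalgebra ℤ_[2] K} {t n : ℤ_[2]} {θ : K}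

local notation "ι" => algebraMap ℤ_[2] K

theorem elt_mem (hS : IsQuadOrder σ S t n θ) (x y : ℤ_[2]) : ι x + ι y * θ ∈ S :=
  (hS.mem_iff _).2 ⟨x, y, rfl⟩

theorem map_elt (hS : IsQuadOrder σ S t n θ) (x y : ℤ_[2]) :
    σ (ι x + ι y * θ) = ι (x + t * y) + ι (-y) * θ := by
  rw [map_add, map_mul, hS.map_algebraMap, hS.map_algebraMap, hS.map_gen]
  simp only [map_add, map_mul, map_neg]
  ring

theorem elt_mul_map (hS : IsQuadOrder σ S t n θ) (x y : ℤ_[2]) :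
    (ι x + ι y * θ) * σ (ι x + ι y * θ) = ι (normForm t n x y) := by
  rw [hS.map_elt]
  simp only [map_add, map_mul, map_neg, normForm]
  linear_combination (-ι y * ι y) * hS.gen_mul_gen

theorem elt_add_map (hS : IsQuadOrder σ S t n θ) (x y : ℤ_[2]) :
    (ι x + ι y * θ) + σ (ι x + ι y * θ) = ι (2 * x + t * y) := by
  rw [hS.map_elt]
  simp only [map_add, map_mul, map_neg, map_ofNat]
  ring

theorem map_mem (hS : IsQuadOrder σ S t n θ) {s : K} (hs : s ∈ S) : σ s ∈ S := by
  obtain ⟨x, y, rfl⟩ := (hS.mem_iff s).1 hs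
  rw [hS.map_elt]
  exact hS.elt_mem _ _

theorem map_map (hS : IsQuadOrder σ S t n θ) {s : K} (hs : s ∈ S) : σ (σ s) = s := by
  obtain ⟨x, y, rfl⟩ := (hS.mem_iff s).1 hs
  rw [hS.map_elt, hS.map_elt]
  simp only [map_add, map_mul, map_neg]
  ring

theorem injective (hS : IsQuadOrder σ S t n θ) : Function.Injective ι := by
  rw [injective_iff_map_eq_zero]
  intro a ha
  exact (hS.indep a 0 (by rw [ha, map_zero, zero_mul, add_zero])).1

theorem elt_inj (hS : IsQuadOrder σ S t n θ) {x y x' y' : ℤ_[2]}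
    (h : ι x + ι y * θ = ι x' + ι y' * θ) : x = x' ∧ y = y' := by
  have := hS.indep (x - x') (y - y') (by simp only [map_sub]; linear_combination h)
  exact ⟨sub_eq_zero.1 this.1, sub_eq_zero.1 this.2⟩

/-- The elements of `S` fixed by the involution lie in `ℤ₂`. -/
theorem exists_of_map_eq (hS : IsQuadOrder σ S t n θ) {s : K} (hs : s ∈ S) (h : σ s = s) :
    ∃ a, s = ι a := by
  obtain ⟨x, y, rfl⟩ := (hS.mem_iff s).1 hs
  rw [hS.map_elt] at h
  have h2 : 2 * y = 0 := by linear_combination -(hS.elt_inj h).2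
  have hy : y = 0 := by simpa using h2
  exact ⟨x, by simp [hy]⟩

theorem exists_norm (hS : IsQuadOrder σ S t n θ) {s : K} (hs : s ∈ S) :
    ∃ a, s * σ s = ι a := by
  obtain ⟨x, y, rfl⟩ := (hS.mem_iff s).1 hs
  exact ⟨_, hS.elt_mul_map x y⟩

/-- An element of `S` with unit norm is invertible in `S`. -/
theorem exists_inv (hS : IsQuadOrder σ S t n θ) {s : K} (hs : s ∈ S) {a : ℤ_[2]}
    (ha : s * σ s = ι a) (hu : IsUnit a) : ∃ s' ∈ S, s * s' = 1 := by
  obtain ⟨b, hb⟩ := hu.exists_right_inv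
  refine ⟨σ s * ι b, S.mul_mem (hS.map_mem hs) (S.algebraMap_mem b), ?_⟩
  rw [← mul_assoc, ha, ← map_mul, hb, map_one]

end IsQuadOrder

/-! ### Orthogonal bases of a lattice -/

section Orth

variable {K : Type*} [CommRing K] [Algebra ℤ_[2] K] {σ : K →+* K}
  {S : Subalgebra ℤ_[2] K} {t n : ℤ_[2]} {θ : K}
  {V : Type*} [AddCommGroup V] [Module K V]

local notation "ι" => algebraMap ℤ_[2] K

/-- `L` has an orthogonal basis whose vectors have the given lengths. -/
def HasOrth (S : Subalgebra ℤ_[2] K) (h : V →ₗ[K] V →ₛₗ[σ] K) (L : Submodule S V)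
    (l : List ℤ_[2]) : Prop :=
  ∃ vs : List V, List.Forall₂ (fun a v => h v v = algebraMap ℤ_[2] K a) l vs ∧
    vs.Pairwise (fun v w => h v w = 0) ∧ Submodule.span S {v | v ∈ vs} = L

variable {h : V →ₗ[K] V →ₛₗ[σ] K} {L : Submodule S V}

theorem HasOrth.perm (hh : ∀ v w, h v w = σ (h w v)) {l l' : List ℤ_[2]}
    (hl : HasOrth S h L l) (hp : l.Perm l') : HasOrth S h L l' := by
  obtain ⟨vs, h1, h2, h3⟩ := hl
  obtain ⟨vs', h4, h5⟩ := List.perm_comp_forall₂ hp.symm h1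
  refine ⟨vs', h4, ?_, ?_⟩
  · refine (h5.pairwise_iff ?_).2 h2
    intro x y hxy
    rw [hh, hxy, map_zero]
  · rw [← h3]
    congr 1
    ext v
    exact h5.mem_iff

theorem smul_coe_mem {M : Submodule S V} {s : K} (hs : s ∈ S) {v : V} (hv : v ∈ M) :
    s • v ∈ M := M.smul_mem ⟨s, hs⟩ hv

/-- Two orthogonal vectors of lengths `a`, `b` may be replaced by vectors of lengths `c`, `abc` if
`c` is a unit represented by `⟨a, b⟩`. -/
theorem HasOrth.binary (hS : IsQuadOrder σ S t n θ) (hh : ∀ v w, h v w = σ (h w v))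
    {a b c : ℤ_[2]} {l : List ℤ_[2]}
    (hl : HasOrth S h L (a :: b :: l)) (hc : IsUnit c) {p q : K} (hp : p ∈ S) (hq : q ∈ S)
    (hpq : ι a * (p * σ p) + ι b * (q * σ q) = ι c) :
    HasOrth S h L (c :: a * b * c :: l) := by
  obtain ⟨vs, h1, h2, h3⟩ := hl
  rw [List.forall₂_cons_left_iff] at h1
  obtain ⟨e, vs, he, h1, rfl⟩ := h1
  rw [List.forall₂_cons_left_iff] at h1
  obtain ⟨f, vs, hf, h1, rfl⟩ := h1
  simp only [List.pairwise_cons, List.mem_cons, forall_eq_or_imp] at h2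
  obtain ⟨⟨hef, he'⟩, hf', h2⟩ := h2
  have hfe : h f e = 0 := by rw [hh, hef, map_zero]
  have hσp := hS.map_mem hp
  have hσq := hS.map_mem hq
  obtain ⟨d, hd⟩ := hc.exists_left_inv
  have hd' : ι d * ι c = 1 := by rw [← map_mul, hd, map_one]
  -- The second vector spans the orthogonal complement of the first. The base change has determinant
  -- `a·p·σ p + b·q·σ q = c`, a unit, so the span is unchanged; `d = c⁻¹` enters the inverse matrix
  -- below.
  refine ⟨(p • e + q • f) :: ((-(ι b * σ q)) • e + (ι a * σ p) • f) :: vs, ?_, ?_, ?_⟩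
  · refine .cons ?_ (.cons ?_ h1)
    · simp only [map_add, map_smul, LinearMap.add_apply, LinearMap.smul_apply, smul_eq_mul,
        LinearMap.map_smulₛₗ, he, hf, hef, hfe]
      linear_combination hpq
    · simp only [map_add, map_smul, LinearMap.add_apply, LinearMap.smul_apply, smul_eq_mul,
        LinearMap.map_smulₛₗ, he, hf, hef, hfe, map_neg, map_mul, hS.map_algebraMap,
        hS.map_map hp, hS.map_map hq]
      linear_combination ι a * ι b * hpq
  · simp only [List.pairwise_cons, List.mem_cons, forall_eq_or_imp]
    refine ⟨⟨?_, ?_⟩, ?_, h2⟩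
    · simp only [map_add, map_smul, LinearMap.add_apply, LinearMap.smul_apply, smul_eq_mul,
        LinearMap.map_smulₛₗ, he, hf, hef, hfe, map_neg, map_mul, hS.map_algebraMap,
        hS.map_map hp, hS.map_map hq]
      ring
    · intro w hw
      simp [he' w hw, hf' w hw]
    · intro w hw
      simp [he' w hw, hf' w hw]
  · rw [← h3]
    apply le_antisymm
    · rw [Submodule.span_le]
      intro v hv
      have me : e ∈ Submodule.span S {v | v ∈ e :: f :: vs} := Submodule.subset_span (by simp)
      have mf : f ∈ Submodule.span S {v | v ∈ e :: f :: vs} := Submodule.subset_span (by simp)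
      simp only [Set.mem_ofPred_eq, List.mem_cons] at hv
      rcases hv with rfl | rfl | hv
      · exact add_mem (smul_coe_mem hp me) (smul_coe_mem hq mf)
      · exact add_mem (smul_coe_mem (S.neg_mem (S.mul_mem (S.algebraMap_mem b) hσq)) me)
          (smul_coe_mem (S.mul_mem (S.algebraMap_mem a) hσp) mf)
      · exact Submodule.subset_span (by simp [hv])
    · rw [Submodule.span_le]
      intro v hv
      set M := Submodule.span S {v | v ∈ (p • e + q • f) ::
        ((-(ι b * σ q)) • e + (ι a * σ p) • f) :: vs} with hM
      have m1 : p • e + q • f ∈ M := Submodule.subset_span (by simp)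
      have m2 : (-(ι b * σ q)) • e + (ι a * σ p) • f ∈ M := Submodule.subset_span (by simp)
      simp only [Set.mem_ofPred_eq, List.mem_cons] at hv
      rcases hv with rfl | rfl | hv
      · have : v = (ι d * (ι a * σ p)) • (p • v + q • f) +
            (-(ι d * q)) • ((-(ι b * σ q)) • v + (ι a * σ p) • f) := by
          have h1 : (ι d * (ι a * σ p)) * p + (-(ι d * q)) * (-(ι b * σ q)) = 1 := by
            linear_combination ι d * hpq + hd'
          have h2 : (ι d * (ι a * σ p)) * q + (-(ι d * q)) * (ι a * σ p) = 0 := by ring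
          linear_combination (norm := module) - h1 • v - h2 • f
        rw [this]
        exact add_mem (smul_coe_mem (S.mul_mem (S.algebraMap_mem d)
          (S.mul_mem (S.algebraMap_mem a) hσp)) m1)
          (smul_coe_mem (S.neg_mem (S.mul_mem (S.algebraMap_mem d) hq)) m2)
      · have : v = (ι d * (ι b * σ q)) • (p • e + q • v) +
            (ι d * p) • ((-(ι b * σ q)) • e + (ι a * σ p) • v) := by
          have h1 : (ι d * (ι b * σ q)) * q + (ι d * p) * (ι a * σ p) = 1 := by
            linear_combination ι d * hpq + hd'
          have h2 : (ι d * (ι b * σ q)) * p + (ι d * p) * (-(ι b * σ q)) = 0 := by ring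
          linear_combination (norm := module) - h1 • v - h2 • e
        rw [this]
        exact add_mem (smul_coe_mem (S.mul_mem (S.algebraMap_mem d)
          (S.mul_mem (S.algebraMap_mem b) hσq)) m1)
          (smul_coe_mem (S.mul_mem (S.algebraMap_mem d) hp) m2)
      · exact Submodule.subset_span (by simp [hv])

/-- The length of a basis vector may be multiplied by the norm of a unit. -/
theorem HasOrth.scale {a c : ℤ_[2]} {l : List ℤ_[2]}
    (hl : HasOrth S h L (a :: l)) {p q : K} (hp : p ∈ S) (hq : q ∈ S) (hpq : p * q = 1)
    (hc : ι a * (p * σ p) = ι c) : HasOrth S h L (c :: l) := by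
  obtain ⟨vs, h1, h2, h3⟩ := hl
  rw [List.forall₂_cons_left_iff] at h1
  obtain ⟨e, vs, he, h1, rfl⟩ := h1
  rw [List.pairwise_cons] at h2
  refine ⟨p • e :: vs, .cons ?_ h1, ?_, ?_⟩
  · simp only [map_smul, LinearMap.smul_apply, smul_eq_mul, LinearMap.map_smulₛₗ, he]
    linear_combination hc
  · rw [List.pairwise_cons]
    exact ⟨fun w hw => by simp [h2.1 w hw], h2.2⟩
  · rw [← h3]
    apply le_antisymm <;> rw [Submodule.span_le] <;> intro v hv <;>
      simp only [Set.mem_ofPred_eq, List.mem_cons] at hv <;> rcases hv with rfl | hv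
    · exact smul_coe_mem hp (Submodule.subset_span (by simp))
    · exact Submodule.subset_span (by simp [hv])
    · have m : q • p • v ∈ Submodule.span S {w | w ∈ p • v :: vs} :=
        smul_coe_mem hq (Submodule.subset_span (by simp))
      rwa [smul_smul, mul_comm, hpq, one_smul] at m
    · exact Submodule.subset_span (by simp [hv])

set_option maxHeartbeats 1000000 in
/-- The lattice `⟨3, 3, 3, c⟩` has another orthogonal basis. -/
theorem HasOrth.quaternary (hS : IsQuadOrder σ S t n θ) (hh : ∀ v w, h v w = σ (h w v))
    {c : ℤ_[2]} {l : List ℤ_[2]} (hl : HasOrth S h L (3 :: 3 :: 3 :: c :: l)) (hc : IsUnit c) :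
    HasOrth S h L (9 :: (6 + c) :: 3 * c * (2 * c + 3) :: 9 * (2 * c + 3) * (c + 6) :: l) := by
  obtain ⟨vs, h1, h2, h3⟩ := hl
  rw [List.forall₂_cons_left_iff] at h1
  obtain ⟨e, vs, he, h1, rfl⟩ := h1
  rw [List.forall₂_cons_left_iff] at h1
  obtain ⟨f, vs, hf, h1, rfl⟩ := h1
  rw [List.forall₂_cons_left_iff] at h1
  obtain ⟨g, vs, hg, h1, rfl⟩ := h1
  rw [List.forall₂_cons_left_iff] at h1
  obtain ⟨k, vs, hk, h1, rfl⟩ := h1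
  simp only [List.pairwise_cons, List.mem_cons, forall_eq_or_imp] at h2
  obtain ⟨⟨hef, heg, hek, he'⟩, ⟨hfg, hfk, hf'⟩, ⟨hgk, hg'⟩, hk', h2⟩ := h2
  have hfe : h f e = 0 := by rw [hh, hef, map_zero]
  have hge : h g e = 0 := by rw [hh, heg, map_zero]
  have hke : h k e = 0 := by rw [hh, hek, map_zero]
  have hgf : h g f = 0 := by rw [hh, hfg, map_zero]
  have hkf : h k f = 0 := by rw [hh, hfk, map_zero]
  have hkg : h k g = 0 := by rw [hh, hgk, map_zero]
  have hσ := hS.map_algebraMap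
  have u3 : IsUnit (3 : ℤ_[2]) := by rw [isUnit_iff_red, map_ofNat]; decide
  have u6 : IsUnit (6 + c) := by
    rw [isUnit_iff_red] at hc ⊢
    rw [map_add, map_ofNat, mul_add, hc]; decide
  have u23 : IsUnit (2 * c + 3) := by
    rw [isUnit_iff_red] at hc ⊢
    rw [map_add, map_mul, map_ofNat, map_ofNat]
    generalize red c = r
    revert r; decide
  -- The new lengths are products of `3`, `c`, `6 + c` and `2c + 3`, and after cancellation the
  -- inverse base change needs only `A`, `B`, `C`, the inverses of `3`, `6 + c` and `2c + 3`.
  obtain ⟨A, hA⟩ := u3.exists_left_inv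
  obtain ⟨B, hB⟩ := u6.exists_left_inv
  obtain ⟨C, hC⟩ := u23.exists_left_inv
  have hA' : ι A * 3 = 1 := by rw [← map_ofNat ι, ← map_mul, hA, map_one]
  have hB' : ι B * (6 + ι c) = 1 := by
    rw [← map_ofNat ι, ← map_add, ← map_mul, hB, map_one]
  have hC' : ι C * (2 * ι c + 3) = 1 := by
    rw [← map_ofNat ι 2, ← map_ofNat ι 3, ← map_mul, ← map_add, ← map_mul, hC, map_one]
  -- The vectors `v₁` and `v₂` are visibly orthogonal; `v₃` and `v₄` complete them to an orthogonal
  -- system. For `c ≡ 3 mod 4` all four lengths are `1` modulo `4`.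
  set v₁ : V := ι 1 • e + ι 1 • f + ι 1 • g with hv₁
  set v₂ : V := ι 1 • e + ι (-1) • f + ι 1 • k with hv₂
  set v₃ : V := ι c • e + ι (-c) • g + ι (-3) • k with hv₃
  set v₄ : V := ι (3 - c) • e + ι (2 * c + 3) • f + ι (-c - 6) • g + ι 9 • k with hv₄
  refine ⟨v₁ :: v₂ :: v₃ :: v₄ :: vs, .cons ?_ (.cons ?_ (.cons ?_ (.cons ?_ h1))), ?_, ?_⟩
  iterate 4
    · simp only [v₁, v₂, v₃, v₄, map_add, map_smul, LinearMap.add_apply, LinearMap.smul_apply,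
        smul_eq_mul, LinearMap.map_smulₛₗ, hσ, he, hf, hg, hk, hef, heg, hek, hfg, hfk, hgk,
        hfe, hge, hke, hgf, hkf, hkg, map_neg, map_sub, map_mul, map_ofNat, map_one]
      ring
  · simp only [List.pairwise_cons, List.mem_cons, forall_eq_or_imp]
    refine ⟨⟨?_, ?_, ?_, ?_⟩, ⟨?_, ?_, ?_⟩, ⟨?_, ?_⟩, ?_, h2⟩
    all_goals first
      | (intro w hw
         simp [v₁, v₂, v₃, v₄, he' w hw, hf' w hw, hg' w hw, hk' w hw])
      | (simp only [v₁, v₂, v₃, v₄, map_add, map_smul, LinearMap.add_apply, LinearMap.smul_apply,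
          smul_eq_mul, LinearMap.map_smulₛₗ, hσ, he, hf, hg, hk, hef, heg, hek, hfg, hfk, hgk,
          hfe, hge, hke, hgf, hkf, hkg, map_neg, map_sub, map_mul, map_ofNat, map_one, map_add]
         ring)
  · have mι : ∀ {M : Submodule S V} (x : ℤ_[2]) {v : V}, v ∈ M → ι x • v ∈ M :=
      fun x _ hv => smul_coe_mem (S.algebraMap_mem x) hv
    rw [← h3]
    apply le_antisymm
    · rw [Submodule.span_le]
      intro v hv
      set M := Submodule.span S {v | v ∈ e :: f :: g :: k :: vs} with hM
      have me : e ∈ M := Submodule.subset_span (by simp)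
      have mf : f ∈ M := Submodule.subset_span (by simp)
      have mg : g ∈ M := Submodule.subset_span (by simp)
      have mk : k ∈ M := Submodule.subset_span (by simp)
      simp only [Set.mem_ofPred_eq, List.mem_cons] at hv
      rcases hv with rfl | rfl | rfl | rfl | hv
      · exact add_mem (add_mem (mι _ me) (mι _ mf)) (mι _ mg)
      · exact add_mem (add_mem (mι _ me) (mι _ mf)) (mι _ mk)
      · exact add_mem (add_mem (mι _ me) (mι _ mg)) (mι _ mk)
      · exact add_mem (add_mem (add_mem (mι _ me) (mι _ mf)) (mι _ mg)) (mι _ mk)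
      · exact Submodule.subset_span (by simp [hv])
    · rw [Submodule.span_le]
      intro v hv
      set M := Submodule.span S {v | v ∈ v₁ :: v₂ :: v₃ :: v₄ :: vs} with hM
      have m1 : v₁ ∈ M := Submodule.subset_span (by simp)
      have m2 : v₂ ∈ M := Submodule.subset_span (by simp)
      have m3 : v₃ ∈ M := Submodule.subset_span (by simp)
      have m4 : v₄ ∈ M := Submodule.subset_span (by simp)
      have hmem : ∀ x y z w : ℤ_[2], ι x • v₁ + ι y • v₂ + ι z • v₃ + ι w • v₄ ∈ M :=
        fun x y z w => add_mem (add_mem (add_mem (mι _ m1) (mι _ m2)) (mι _ m3)) (mι _ m4)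
      -- coordinates of a vector with respect to the new basis
      have key : ∀ x y z w r₁ r₂ r₃ r₄ : ℤ_[2],
          x + y + z * c + w * (3 - c) = r₁ → x - y + w * (2 * c + 3) = r₂ →
          x - z * c + w * (-c - 6) = r₃ → y - 3 * z + 9 * w = r₄ →
          ι r₁ • e + ι r₂ • f + ι r₃ • g + ι r₄ • k ∈ M := by
        rintro x y z w _ _ _ _ rfl rfl rfl rfl
        convert hmem x y z w using 1
        simp only [v₁, v₂, v₃, v₄, map_add, map_sub, map_mul, map_neg, map_one, map_ofNat]
        module
      simp only [Set.mem_ofPred_eq, List.mem_cons] at hv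
      rcases hv with rfl | rfl | rfl | rfl | hv
      -- The coefficient of `vᵢ` in an old basis vector `x` is `h(x, vᵢ) / h(vᵢ, vᵢ)`; this gives
      -- the witnesses here and in the next three cases.
      · simpa using key A (3 * B) C (A * B * C * (3 - c)) 1 0 0 0
          (by clear * - hA hB hC; grind) (by clear * - hA hB hC; grind)
          (by clear * - hA hB hC; grind) (by clear * - hA hB hC; grind)
      · simpa using key A (-3 * B) 0 (A * B) 0 1 0 0
          (by clear * - hA hB hC; grind) (by clear * - hA hB hC; grind)
          (by clear * - hA hB hC; grind) (by clear * - hA hB hC; grind)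
      · simpa using key A 0 (-C) (-A * C) 0 0 1 0
          (by clear * - hA hB hC; grind) (by clear * - hA hB hC; grind)
          (by clear * - hA hB hC; grind) (by clear * - hA hB hC; grind)
      · simpa using key 0 (c * B) (-C) (c * B * C) 0 0 0 1
          (by clear * - hA hB hC; grind) (by clear * - hA hB hC; grind)
          (by clear * - hA hB hC; grind) (by clear * - hA hB hC; grind)
      · exact Submodule.subset_span (by simp [hv])

end Orth

/-! ### Reduction of diagonal forms -/

section Reduction

variable {K : Type*} [CommRing K] [Algebra ℤ_[2] K] {σ : K →+* K}
  {S : Subalgebra ℤ_[2] K} {t n : ℤ_[2]} {θ : K}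
  {V : Type*} [AddCommGroup V] [Module K V]
  {h : V →ₗ[K] V →ₛₗ[σ] K} {L : Submodule S V}

local notation "ι" => algebraMap ℤ_[2] K

theorem red_two_mul_of_isUnit {a : ℤ_[2]} (ha : IsUnit a) : 2 * red a = 2 ∨ 2 * red a = 6 := by
  rw [isUnit_iff_red] at ha
  generalize red a = r at *
  revert r; decide

/-- It suffices to represent `c` modulo `8`. -/
theorem HasOrth.binary_of_red (hS : IsQuadOrder σ S t n θ) (hh : ∀ v w, h v w = σ (h w v))
    {a b c : ℤ_[2]} {l : List ℤ_[2]}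
    (hl : HasOrth S h L (a :: b :: l)) (hc : IsUnit c) (x y z w : ℤ_[2])
    (hxy : red (a * normForm t n x y + b * normForm t n z w) = red c) :
    HasOrth S h L (c :: a * b * c :: l) := by
  obtain ⟨m, hm⟩ := exists_sq_of_red_eq hc hxy
  refine hl.binary hS hh hc (hS.elt_mem (m * x) (m * y)) (hS.elt_mem (m * z) (m * w)) ?_
  rw [hS.elt_mul_map, hS.elt_mul_map, ← map_mul, ← map_mul, ← map_add, ← hm]
  congr 1
  simp only [normForm]
  ring

/-- For trace one, `⟨a⟩` alone represents `1`, so the second vector is not used; for trace zero and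
`4 ∤ n` both vectors are available. -/
theorem HasOrth.binary_one_of_trace_or_norm (hS : IsQuadOrder σ S t n θ)
    (hh : ∀ v w, h v w = σ (h w v)) (htn : t = 1 ∨ 2 * red n ≠ 0)
    {a b : ℤ_[2]} {l : List ℤ_[2]} (ha : IsUnit a) (hb : IsUnit b)
    (hl : HasOrth S h L (a :: b :: l)) : HasOrth S h L (1 :: a * b :: l) := by
  rw [isUnit_iff_red] at ha hb
  have main : t = 1 ∨ (t = 0 ∧ 2 * red n ≠ 0) := by
    rcases htn with h1 | h1
    · exact .inl h1
    · exact hS.trace_eq.symm.imp id fun h0 => ⟨h0, h1⟩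
  rw [← mul_one (a * b)]
  rcases main with rfl | ⟨rfl, hn⟩
  · obtain ⟨x, y, hxy⟩ := exists_norm_mul_eq_one_of_trace_one (red n) (red a) ha
    obtain ⟨x, rfl⟩ := red_surjective x
    obtain ⟨y, rfl⟩ := red_surjective y
    refine hl.binary_of_red hS hh isUnit_one x y 0 0 ?_
    simp only [normForm, map_add, map_mul, map_one, mul_zero, add_zero]
    exact hxy
  · obtain ⟨x, y, z, w, hxy⟩ :=
      exists_binary_eq_one_of_not_four_dvd (red n) (red a) (red b) hn ha hb
    refine hl.binary_of_red hS hh isUnit_one x.val y.val z.val w.val ?_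
    simp only [normForm, map_add, map_mul, map_one, zero_mul, add_zero, map_natCast]
    exact hxy

/-- If `a ≡ c mod 4` then `⟨a, b⟩` represents `c`. -/
theorem HasOrth.binary_of_two_mul (hS : IsQuadOrder σ S t n θ)
    (hh : ∀ v w, h v w = σ (h w v)) {a b c : ℤ_[2]} {l : List ℤ_[2]} (hc : IsUnit c)
    (hb : IsUnit b) (hac : 2 * red a = 2 * red c)
    (hl : HasOrth S h L (a :: b :: l)) : HasOrth S h L (c :: a * b * c :: l) := by
  -- For orthogonal `e`, `f` of lengths `a`, `b` the vector `e + 2f` has length `a + 4b ≡ a + 4 mod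
  -- 8`, which reaches the other class modulo `8` over `a mod 4`.
  have key : ∀ a b c : ZMod 8, 4 * b = 4 → 2 * a = 2 * c → a = c ∨ a + b * 4 = c := by decide
  rcases key _ _ _ ((isUnit_iff_red b).1 hb) hac with h1 | h1
  · refine hl.binary_of_red hS hh hc 1 0 0 0 ?_
    simp [normForm, h1]
  · refine hl.binary_of_red hS hh hc 1 0 2 0 ?_
    rw [← h1]
    simp only [normForm, map_add, map_mul, mul_zero, add_zero, mul_one,
      map_ofNat]
    congr 2

/-- A sweep through the list: the head `a` and the next entry `b` become `1` and `ab`, and `ab` is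
the new head. The number `j` counts the ones already produced; the last head `w` is left to the
determinant. -/
theorem HasOrth.ones_of_trace_or_norm (hS : IsQuadOrder σ S t n θ)
    (hh : ∀ v w, h v w = σ (h w v)) (htn : t = 1 ∨ 2 * red n ≠ 0) (l : List ℤ_[2]) :
    ∀ (a : ℤ_[2]) (j : ℕ), IsUnit a → (∀ b ∈ l, IsUnit b) →
      HasOrth S h L (a :: (l ++ List.replicate j 1)) →
      ∃ w, HasOrth S h L (w :: List.replicate (l.length + j) 1) := by
  induction l with
  | nil =>
    intro a j _ _ hl
    exact ⟨a, by simpa using hl⟩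
  | cons b l ih =>
    intro a j ha hu hl
    rw [List.forall_mem_cons] at hu
    have h1 := hl.binary_one_of_trace_or_norm hS hh htn ha hu.1
    obtain ⟨w, hw⟩ := ih (a * b) (j + 1) (ha.mul hu.1) hu.2 (h1.perm hh (by
      rw [List.replicate_succ]
      exact (List.Perm.swap _ _ _).trans (List.Perm.cons _ List.perm_middle.symm)))
    exact ⟨w, by rwa [List.length_cons, add_assoc, add_comm 1 j]⟩

theorem isUnit_three : IsUnit (3 : ℤ_[2]) := by
  rw [isUnit_iff_red, map_ofNat]; decide

/-- The same sweep when only `⟨a, b⟩ → c` with `c ≡ a mod 4` is available: the head is turned into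
`1` or `3` according to its class modulo `4`. -/
theorem HasOrth.ones_threes (hS : IsQuadOrder σ S t n θ)
    (hh : ∀ v w, h v w = σ (h w v)) (l : List ℤ_[2]) :
    ∀ (a : ℤ_[2]) (i j : ℕ), IsUnit a → (∀ b ∈ l, IsUnit b) →
      HasOrth S h L (a :: (l ++ (List.replicate i 3 ++ List.replicate j 1))) →
      ∃ w i' j', IsUnit w ∧ i' + j' = l.length + i + j ∧
        HasOrth S h L (w :: (List.replicate i' 3 ++ List.replicate j' 1)) := by
  induction l with
  | nil =>
    intro a i j ha _ hl
    exact ⟨a, i, j, ha, by simp, by simpa using hl⟩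
  | cons b l ih =>
    intro a i j ha hu hl
    rw [List.forall_mem_cons] at hu
    rw [List.cons_append] at hl
    rcases red_two_mul_of_isUnit ha with h2 | h2
    · have h1 := hl.binary_of_two_mul hS hh isUnit_one hu.1 (by rw [h2, map_one]; decide)
      obtain ⟨w, i', j', hw, hij, hw'⟩ := ih (a * b * 1) i (j + 1) (by simpa using ha.mul hu.1)
        hu.2 (h1.perm hh (by
          rw [List.replicate_succ, ← List.append_assoc, ← List.append_assoc]
          exact (List.Perm.swap _ _ _).trans (List.Perm.cons _ List.perm_middle.symm)))
      exact ⟨w, i', j', hw, by rw [hij, List.length_cons]; ring, hw'⟩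
    · have h1 := hl.binary_of_two_mul hS hh isUnit_three hu.1 (by rw [h2, map_ofNat]; decide)
      obtain ⟨w, i', j', hw, hij, hw'⟩ := ih (a * b * 3) (i + 1) j ((ha.mul hu.1).mul isUnit_three)
        hu.2 (h1.perm hh (by
          rw [List.replicate_succ]
          exact (List.Perm.swap _ _ _).trans (List.Perm.cons _ List.perm_middle.symm)))
      exact ⟨w, i', j', hw, by rw [hij, List.length_cons]; ring, hw'⟩

/-- Four lengths congruent to `1` modulo `4` may be replaced by `1, 1, 1` and their product. -/
theorem HasOrth.four_ones (hS : IsQuadOrder σ S t n θ)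
    (hh : ∀ v w, h v w = σ (h w v)) {a b c d : ℤ_[2]} {l : List ℤ_[2]} (ha : 2 * red a = 2)
    (hb : 2 * red b = 2) (hc : 2 * red c = 2) (hd : 2 * red d = 2)
    (hl : HasOrth S h L (a :: b :: c :: d :: l)) :
    HasOrth S h L (a * b * c * d :: 1 :: 1 :: 1 :: l) := by
  have h12 : 2 * red (1 : ℤ_[2]) = 2 := by rw [map_one]; decide
  have hu : ∀ {e : ℤ_[2]}, 2 * red e = 2 → IsUnit e := fun {e} he => by
    rw [isUnit_iff_red]
    generalize red e = r at he
    revert r; decide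
  have hm : ∀ {e f : ℤ_[2]}, 2 * red e = 2 → 2 * red f = 2 → 2 * red (e * f * 1) = 2 :=
    fun {e f} he hf => by
      rw [mul_one, map_mul, ← mul_assoc, he, hf]
  have h1 := (hl.binary_of_two_mul hS hh isUnit_one (hu hb) (ha.trans h12.symm)).perm hh
    (l' := (a * b * 1) :: c :: 1 :: d :: l)
    ((List.Perm.swap _ _ _).trans ((List.Perm.swap _ _ _).cons _))
  have h2 := (h1.binary_of_two_mul hS hh isUnit_one (hu hc) ((hm ha hb).trans h12.symm)).perm hh
    (l' := (a * b * 1 * c * 1) :: d :: 1 :: 1 :: l)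
    ((List.Perm.swap _ _ _).trans (List.Perm.cons _ (by
      rw [← Multiset.coe_eq_coe]
      simp only [← Multiset.cons_coe, ← Multiset.singleton_add]
      abel)))
  have h3 := (h2.binary_of_two_mul hS hh isUnit_one (hu hd)
    ((hm (hm ha hb) hc).trans h12.symm)).perm hh (List.Perm.swap _ _ _)
  simpa only [mul_one] using h3

/-- Normal forms of diagonal lattices of rank at least `3`. -/
theorem HasOrth.normal_form (hS : IsQuadOrder σ S t n θ)
    (hh : ∀ v w, h v w = σ (h w v)) (i : ℕ) : ∀ (w : ℤ_[2]) (j : ℕ), IsUnit w → 2 ≤ i + j →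
      HasOrth S h L (w :: (List.replicate i 3 ++ List.replicate j 1)) →
      ∃ w', HasOrth S h L (w' :: List.replicate (i + j) 1) ∨
        HasOrth S h L (w' :: 3 :: 3 :: List.replicate (i + j - 2) 1) := by
  -- The induction removes entries `3`. If `w ≡ 1 mod 4`, then `⟨w, 3⟩` becomes `⟨1, 3w⟩` and one
  -- disappears; if `w ≡ 3 mod 4` and three are present, `quaternary` and `four_ones` remove all
  -- three.
  induction i using Nat.strong_induction_on with
  | _ i ih =>
  intro w j hw hij hl
  have h12 : 2 * red (1 : ℤ_[2]) = 2 := by rw [map_one]; decide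
  have h36 : 2 * red (3 : ℤ_[2]) = 6 := by rw [map_ofNat]; decide
  match i with
  | 0 => exact ⟨w, .inl (by simpa using hl)⟩
  | 1 =>
    rcases red_two_mul_of_isUnit hw with h2 | h2
    · have h1 := hl.binary_of_two_mul hS hh isUnit_one isUnit_three (h2.trans h12.symm)
      refine ⟨w * 3 * 1, .inl ?_⟩
      rw [add_comm, List.replicate_succ]
      exact h1.perm hh (List.Perm.swap _ _ _)
    -- Rank at least `3` provides an entry `1`, with which `w` is turned into a second `3`.
    · obtain ⟨j, rfl⟩ : ∃ k, j = k + 1 := ⟨j - 1, by omega⟩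
      have h1 : HasOrth S h L (w :: 1 :: 3 :: List.replicate j 1) :=
        hl.perm hh ((List.Perm.swap _ _ _).cons _)
      have h3 := h1.binary_of_two_mul hS hh isUnit_three isUnit_one (h2.trans h36.symm)
      refine ⟨w * 1 * 3, .inr ?_⟩
      rw [show 1 + (j + 1) - 2 = j by omega]
      exact h3.perm hh (List.Perm.swap _ _ _)
  | 2 => exact ⟨w, .inr (by simpa [List.replicate_succ] using hl)⟩
  | i + 3 =>
    rcases red_two_mul_of_isUnit hw with h2 | h2
    · have h1 := hl.binary_of_two_mul hS hh isUnit_one isUnit_three (h2.trans h12.symm)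
      have h3 := ih (i + 2) (by omega) (w * 3 * 1) (j + 1) (by simpa using hw.mul isUnit_three)
        (by omega) (h1.perm hh (by
          rw [List.replicate_succ (n := j)]
          exact (List.Perm.swap _ _ _).trans (List.Perm.cons _ List.perm_middle.symm)))
      rwa [show i + 3 + j = i + 2 + (j + 1) by omega]
    · have h1 : HasOrth S h L (3 :: 3 :: 3 :: w :: (List.replicate i 3 ++ List.replicate j 1)) :=
        hl.perm hh (by
          rw [← Multiset.coe_eq_coe]
          simp only [List.replicate_succ, ← Multiset.cons_coe, ← Multiset.singleton_add,
            List.cons_append]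
          abel)
      have h3 := h1.quaternary hS hh hw
      have d1 : ∀ r : ZMod 8, 2 * r = 6 → 2 * (6 + r) = 2 := by decide
      have d2 : ∀ r : ZMod 8, 2 * r = 6 → 2 * (3 * r * (2 * r + 3)) = 2 := by decide
      have d3 : ∀ r : ZMod 8, 2 * r = 6 → 2 * (9 * (2 * r + 3) * (r + 6)) = 2 := by decide
      have c0 : 2 * red (9 : ℤ_[2]) = 2 := by rw [map_ofNat]; decide
      have c1 : 2 * red (6 + w) = 2 := by
        rw [map_add, map_ofNat]; exact d1 _ h2
      have c2 : 2 * red (3 * w * (2 * w + 3)) = 2 := by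
        simp only [map_mul, map_add, map_ofNat]; exact d2 _ h2
      have c3 : 2 * red (9 * (2 * w + 3) * (w + 6)) = 2 := by
        simp only [map_mul, map_add, map_ofNat]; exact d3 _ h2
      obtain ⟨W, hW, h4⟩ : ∃ W, IsUnit W ∧
          HasOrth S h L (W :: 1 :: 1 :: 1 :: (List.replicate i 3 ++ List.replicate j 1)) := by
        refine ⟨_, ?_, h3.four_ones hS hh c0 c1 c2 c3⟩
        rw [isUnit_iff_red, map_mul, map_mul, map_mul]
        have : ∀ a b c d : ZMod 8, 2 * a = 2 → 2 * b = 2 → 2 * c = 2 → 2 * d = 2 →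
            4 * (a * b * c * d) = 4 := by
          intro a b c d ha hb hc hd
          linear_combination (2 * (b * c * d)) * ha + (2 * (c * d)) * hb + 2 * d * hc + 2 * hd
        exact this _ _ _ _ c0 c1 c2 c3
      have h5 := ih i (by omega) W (j + 3) hW (by omega) (h4.perm hh (by
          rw [← Multiset.coe_eq_coe]
          simp only [List.replicate_succ, ← Multiset.cons_coe, ← Multiset.singleton_add,
            ← Multiset.coe_add]
          abel))
      rwa [show i + 3 + j = i + (j + 3) by omega]

end Reduction

/-! ### Existence of orthogonal bases -/

section Diagonalization

variable {K : Type*} [CommRing K] [Algebra ℤ_[2] K] {σ : K →+* K}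
  {S : Subalgebra ℤ_[2] K} {t n : ℤ_[2]} {θ : K}
  {V : Type*} [AddCommGroup V] [Module K V]

local notation "ι" => algebraMap ℤ_[2] K

/-- A family of vectors spanning a unimodular lattice: the form is integral on the family, and
every integral functional on the family is represented by a vector in its span. -/
structure IsUnimodularFamily (S : Subalgebra ℤ_[2] K) (h : V →ₗ[K] V →ₛₗ[σ] K) {m : ℕ}
    (b : Fin m → V) : Prop where
  integral : ∀ i j, h (b i) (b j) ∈ S
  represents : ∀ f : Fin m → K, (∀ j, f j ∈ S) →
    ∃ c ∈ Submodule.span S (Set.range b), ∀ j, h (b j) c = f j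

variable {h : V →ₗ[K] V →ₛₗ[σ] K} {m : ℕ}

theorem form_mem_of_mem_span (hS : IsQuadOrder σ S t n θ) {s s' : Set V}
    (hb : ∀ v ∈ s, ∀ w ∈ s', h v w ∈ S) {x y : V} (hx : x ∈ Submodule.span S s)
    (hy : y ∈ Submodule.span S s') : h x y ∈ S := by
  induction hx using Submodule.span_induction with
  | zero => rw [map_zero, LinearMap.zero_apply]; exact S.zero_mem
  | add x x' _ _ ih ih' => rw [map_add, LinearMap.add_apply]; exact S.add_mem ih ih'
  | smul c x _ ih =>
    have : h (c • x) y = (c : K) * h x y := by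
      rw [Subalgebra.smul_def, map_smul, LinearMap.smul_apply, smul_eq_mul]
    rw [this]
    exact S.mul_mem c.2 ih
  | mem x hx =>
    induction hy using Submodule.span_induction with
    | zero => rw [map_zero]; exact S.zero_mem
    | add x x' _ _ ih ih' => rw [map_add]; exact S.add_mem ih ih'
    | smul c y _ ih =>
      have : h x (c • y) = σ c * h x y := by
        rw [Subalgebra.smul_def, LinearMap.map_smulₛₗ, smul_eq_mul]
      rw [this]
      exact S.mul_mem (hS.map_mem c.2) ih
    | mem y hy => exact hb x hx y hy

theorem IsUnimodularFamily.form_mem (hS : IsQuadOrder σ S t n θ) {b : Fin m → V}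
    (hb : IsUnimodularFamily S h b) {x y : V} (hx : x ∈ Submodule.span S (Set.range b))
    (hy : y ∈ Submodule.span S (Set.range b)) : h x y ∈ S :=
  form_mem_of_mem_span hS (by rintro _ ⟨i, rfl⟩ _ ⟨j, rfl⟩; exact hb.integral i j) hx hy

theorem span_range_update_add {b : Fin m → V} {i j : Fin m} (hij : i ≠ j) {r : K} (hr : r ∈ S) :
    Submodule.span S (Set.range (Function.update b i (b i + r • b j))) =
      Submodule.span S (Set.range b) := by
  apply le_antisymm <;> rw [Submodule.span_le] <;> rintro _ ⟨k, rfl⟩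
  · by_cases hk : k = i
    · subst hk
      rw [Function.update_self]
      exact add_mem (Submodule.subset_span ⟨k, rfl⟩)
        (smul_coe_mem hr (Submodule.subset_span ⟨j, rfl⟩))
    · rw [Function.update_of_ne hk]
      exact Submodule.subset_span ⟨k, rfl⟩
  · set b' := Function.update b i (b i + r • b j) with hb'
    have hj : b j ∈ Submodule.span S (Set.range b') :=
      Submodule.subset_span ⟨j, by rw [hb', Function.update_of_ne hij.symm]⟩
    by_cases hk : k = i
    · subst hk
      have h1 : b k + r • b j ∈ Submodule.span S (Set.range b') :=
        Submodule.subset_span ⟨k, by rw [hb', Function.update_self]⟩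
      have h2 := sub_mem h1 (smul_coe_mem hr hj)
      rwa [add_sub_cancel_right] at h2
    · exact Submodule.subset_span ⟨k, by rw [hb', Function.update_of_ne hk]⟩

theorem IsUnimodularFamily.update_add (hS : IsQuadOrder σ S t n θ) {b : Fin m → V}
    (hb : IsUnimodularFamily S h b) {i j : Fin m} (hij : i ≠ j) {r : K} (hr : r ∈ S) :
    IsUnimodularFamily S h (Function.update b i (b i + r • b j)) := by
  have hspan := span_range_update_add (b := b) hij hr
  refine ⟨fun k l => ?_, fun f hf => ?_⟩
  · refine hb.form_mem hS ?_ ?_ <;> rw [← hspan] <;> exact Submodule.subset_span ⟨_, rfl⟩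
  -- The prescribed values on the new family, rewritten as values on the old one.
  · obtain ⟨c, hc, hc'⟩ := hb.represents (Function.update f i (f i - r * f j)) (by
      intro k
      by_cases hk : k = i
      · subst hk
        rw [Function.update_self]
        exact S.sub_mem (hf k) (S.mul_mem hr (hf j))
      · rw [Function.update_of_ne hk]
        exact hf k)
    refine ⟨c, hspan ▸ hc, fun k => ?_⟩
    by_cases hk : k = i
    · subst hk
      rw [Function.update_self, map_add, LinearMap.add_apply, map_smul, LinearMap.smul_apply, hc',
        hc', Function.update_self, Function.update_of_ne hij.symm, smul_eq_mul, sub_add_cancel]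
    · rw [Function.update_of_ne hk, hc', Function.update_of_ne hk]

/-- The projection of the remaining vectors of `b` to the orthogonal complement of `b p`, where
`e` is the inverse of the length of `b p`. -/
def complFamily (h : V →ₗ[K] V →ₛₗ[σ] K) (b : Fin (m + 1) → V) (p : Fin (m + 1)) (e : ℤ_[2]) :
    Fin m → V :=
  fun j => b (p.succAbove j) - (h (b (p.succAbove j)) (b p) * algebraMap ℤ_[2] K e) • b p

theorem complFamily_orth {b : Fin (m + 1) → V} {p : Fin (m + 1)} {a e : ℤ_[2]}
    (ha : h (b p) (b p) = ι a) (hae : a * e = 1) (j : Fin m) :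
    h (complFamily h b p e j) (b p) = 0 := by
  have hae' : ι a * ι e = 1 := by rw [← map_mul, hae, map_one]
  simp only [complFamily, map_sub, map_smul, LinearMap.sub_apply, LinearMap.smul_apply, ha,
    smul_eq_mul]
  linear_combination (-h (b (p.succAbove j)) (b p)) * hae'

theorem span_complFamily {b : Fin (m + 1) → V} (hb : IsUnimodularFamily S h b)
    (p : Fin (m + 1)) (e : ℤ_[2]) :
    Submodule.span S (Set.range b) =
      Submodule.span S {b p} ⊔ Submodule.span S (Set.range (complFamily h b p e)) := by
  have hm : ∀ j, h (b (p.succAbove j)) (b p) * ι e ∈ S := fun j =>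
    S.mul_mem (hb.integral _ _) (S.algebraMap_mem e)
  apply le_antisymm
  · rw [Submodule.span_le]
    rintro _ ⟨k, rfl⟩
    have hp : b p ∈ Submodule.span S {b p} := Submodule.mem_span_singleton_self _
    rcases Fin.eq_self_or_eq_succAbove p k with rfl | ⟨j, rfl⟩
    · exact Submodule.mem_sup_left hp
    · have := Submodule.add_mem_sup (smul_coe_mem (hm j) hp)
        (Submodule.subset_span (R := S) (s := Set.range (complFamily h b p e)) ⟨j, rfl⟩)
      simpa only [complFamily, add_sub_cancel, SetLike.mem_coe] using this
  · refine sup_le ?_ ?_ <;> rw [Submodule.span_le]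
    · rintro _ rfl
      exact Submodule.subset_span ⟨p, rfl⟩
    · rintro _ ⟨j, rfl⟩
      exact sub_mem (Submodule.subset_span ⟨_, rfl⟩)
        (smul_coe_mem (hm j) (Submodule.subset_span ⟨_, rfl⟩))

/-- A functional on the complement is extended by `0` at `b p`. The vector representing the
extension is orthogonal to `b p`, so it has no `b p` component and lies in the span of the
complement. -/
theorem IsUnimodularFamily.compl (hS : IsQuadOrder σ S t n θ)
    (hh : ∀ v w, h v w = σ (h w v)) {b : Fin (m + 1) → V}
    (hb : IsUnimodularFamily S h b) {p : Fin (m + 1)} {a e : ℤ_[2]}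
    (ha : h (b p) (b p) = ι a) (hae : a * e = 1) :
    IsUnimodularFamily S h (complFamily h b p e) := by
  have hspan := span_complFamily hb p e
  have horth := complFamily_orth (h := h) ha hae
  have hae' : ι a * ι e = 1 := by rw [← map_mul, hae, map_one]
  refine ⟨fun k l => ?_, fun f hf => ?_⟩
  · refine hb.form_mem hS ?_ ?_ <;> rw [hspan] <;>
      exact Submodule.mem_sup_right (Submodule.subset_span ⟨_, rfl⟩)
  · obtain ⟨c, hc, hc'⟩ := hb.represents (p.insertNth 0 f) (by
      intro k
      rcases Fin.eq_self_or_eq_succAbove p k with rfl | ⟨j, rfl⟩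
      · rw [Fin.insertNth_apply_same]; exact S.zero_mem
      · rw [Fin.insertNth_apply_succAbove]; exact hf j)
    have hp : h (b p) c = 0 := by rw [hc', Fin.insertNth_apply_same]
    refine ⟨c, ?_, fun j => ?_⟩
    · rw [hspan, Submodule.mem_sup] at hc
      obtain ⟨y, hy, z, hz, rfl⟩ := hc
      obtain ⟨r, rfl⟩ := Submodule.mem_span_singleton.1 hy
      have hz0 : h z (b p) = 0 := by
        clear hc' hp
        induction hz using Submodule.span_induction with
        | zero => simp
        | add x y _ _ hx hy => rw [map_add, LinearMap.add_apply, hx, hy, add_zero]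
        | smul s x _ hx =>
          rw [Subalgebra.smul_def, map_smul, LinearMap.smul_apply, hx, smul_zero]
        | mem x hx => obtain ⟨j, rfl⟩ := hx; exact horth j
      have h0 : h (r • b p + z) (b p) = 0 := by rw [hh, hp, map_zero]
      rw [Subalgebra.smul_def, map_add, LinearMap.add_apply, hz0, map_smul, LinearMap.smul_apply,
        ha, smul_eq_mul, add_zero] at h0
      have hr : (r : K) = 0 := by linear_combination ι e * h0 - (r : K) * hae'
      rw [Subalgebra.smul_def, hr, zero_smul, zero_add]
      exact hz
    · simp only [complFamily, map_sub, map_smul, LinearMap.sub_apply, LinearMap.smul_apply,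
        hp, smul_zero, sub_zero]
      rw [hc', Fin.insertNth_apply_succAbove]

theorem HasOrth.of_complFamily (hh : ∀ v w, h v w = σ (h w v))
    {b : Fin (m + 1) → V} (hb : IsUnimodularFamily S h b) {p : Fin (m + 1)} {a e : ℤ_[2]}
    (ha : h (b p) (b p) = ι a) (hae : a * e = 1) {l : List ℤ_[2]}
    (hl : HasOrth S h (Submodule.span S (Set.range (complFamily h b p e))) l) :
    HasOrth S h (Submodule.span S (Set.range b)) (a :: l) := by
  have horth := complFamily_orth (h := h) ha hae
  obtain ⟨vs, h1, h2, h3⟩ := hl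
  refine ⟨b p :: vs, .cons ha h1, List.pairwise_cons.2 ⟨fun w hw => ?_, h2⟩, ?_⟩
  · have hw' : w ∈ Submodule.span S (Set.range (complFamily h b p e)) :=
      h3 ▸ Submodule.subset_span hw
    have hw0 : h w (b p) = 0 := by
      clear hw
      induction hw' using Submodule.span_induction with
      | zero => simp
      | add x y _ _ hx hy => rw [map_add, LinearMap.add_apply, hx, hy, add_zero]
      | smul s x _ hx =>
        rw [Subalgebra.smul_def, map_smul, LinearMap.smul_apply, hx, smul_zero]
      | mem x hx => obtain ⟨j, rfl⟩ := hx; exact horth j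
    rw [hh, hw0, map_zero]
  · rw [span_complFamily hb p e, ← h3, ← Submodule.span_union]
    congr 1
    ext v
    simp

/-- Adjoining an orthogonal vector of unit length to a unimodular family. -/
theorem IsUnimodularFamily.cons (hS : IsQuadOrder σ S t n θ)
    (hh : ∀ v w, h v w = σ (h w v)) {b : Fin m → V}
    (hb : IsUnimodularFamily S h b) {v : V} {a : ℤ_[2]} (ha : h v v = ι a) (hu : IsUnit a)
    (hv : ∀ j, h (b j) v = 0) : IsUnimodularFamily S h (Fin.cons v b : Fin (m + 1) → V) := by
  have hv' : ∀ j, h v (b j) = 0 := fun j => by rw [hh, hv, map_zero]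
  obtain ⟨e, hae⟩ := hu.exists_right_inv
  have hae' : ι a * ι e = 1 := by rw [← map_mul, hae, map_one]
  have hle : Submodule.span S (Set.range b) ≤
      Submodule.span S (Set.range (Fin.cons v b : Fin (m + 1) → V)) := by
    apply Submodule.span_mono
    rintro _ ⟨j, rfl⟩
    exact ⟨j.succ, by rw [Fin.cons_succ]⟩
  refine ⟨fun i j => ?_, fun f hf => ?_⟩
  · refine Fin.cases ?_ (fun i => ?_) i <;> refine Fin.cases ?_ (fun j => ?_) j <;>
      simp only [Fin.cons_zero, Fin.cons_succ]
    · rw [ha]; exact S.algebraMap_mem a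
    · rw [hv']; exact S.zero_mem
    · rw [hv]; exact S.zero_mem
    · exact hb.integral i j
  · obtain ⟨c, hc, hc'⟩ := hb.represents (fun j => f j.succ) fun j => hf _
    have hvc : h v c = 0 := by
      clear hc'
      induction hc using Submodule.span_induction with
      | zero => simp
      | add x y _ _ hx hy => rw [map_add, hx, hy, add_zero]
      | smul s x _ hx =>
        rw [Subalgebra.smul_def, LinearMap.map_smulₛₗ, hx, smul_zero]
      | mem x hx => obtain ⟨j, rfl⟩ := hx; exact hv' j
    have hσσ := hS.map_map (hf 0)
    -- The form is conjugate-linear in its second variable, hence `σ (f 0)` in the coefficient; `e`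
    -- is the inverse of the length of `v`.
    refine ⟨(σ (f 0) * ι e) • v + c, add_mem (smul_coe_mem
      (S.mul_mem (hS.map_mem (hf 0)) (S.algebraMap_mem e)) (Submodule.subset_span ⟨0, rfl⟩))
      (hle hc), fun j => ?_⟩
    refine Fin.cases ?_ (fun j => ?_) j
    · rw [Fin.cons_zero, map_add, LinearMap.map_smulₛₗ, hvc, ha, add_zero, smul_eq_mul, map_mul,
        hσσ, hS.map_algebraMap]
      linear_combination f 0 * hae'
    · rw [Fin.cons_succ, map_add, LinearMap.map_smulₛₗ, hv, smul_zero, zero_add, hc']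

end Diagonalization

/-! ### Vectors of unit length and the splitting of the lattice -/

section Diagonalization

variable {K : Type*} [CommRing K] [Algebra ℤ_[2] K] {σ : K →+* K}
  {S : Subalgebra ℤ_[2] K} {t n : ℤ_[2]} {θ : K}
  {V : Type*} [AddCommGroup V] [Module K V]
  {h : V →ₗ[K] V →ₛₗ[σ] K} {m : ℕ}

local notation "ι" => algebraMap ℤ_[2] K

theorem IsUnimodularFamily.exists_length (hS : IsQuadOrder σ S t n θ)
    (hh : ∀ v w, h v w = σ (h w v)) {b : Fin m → V}
    (hb : IsUnimodularFamily S h b) {v : V} (hv : v ∈ Submodule.span S (Set.range b)) :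
    ∃ a, h v v = ι a :=
  hS.exists_of_map_eq (hb.form_mem hS hv hv) (hh v v).symm

/-- The entries of a row of the Gram matrix of a unimodular family generate the unit ideal. -/
theorem IsUnimodularFamily.row_induction (hS : IsQuadOrder σ S t n θ) {b : Fin (m + 1) → V}
    (hb : IsUnimodularFamily S h b) (E : K → Prop) (h0 : E 0) (hadd : ∀ x y, E x → E y → E (x + y))
    (hmul : ∀ s ∈ S, ∀ x, E x → E (s * x)) (hE : ∀ j, E (h (b 0) (b j))) : E 1 := by
  -- Since `h (b 0) c = 1` and `c` is an `S`-combination of the family, `1` is an `S`-combination of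
  -- the row.
  obtain ⟨c, hc, hc'⟩ := hb.represents (fun j => if j = 0 then 1 else 0) (by
    intro j
    split_ifs
    exacts [S.one_mem, S.zero_mem])
  have h1 : h (b 0) c = 1 := by rw [hc', if_pos rfl]
  rw [← h1]
  clear hc' h1
  induction hc using Submodule.span_induction with
  | zero => rw [map_zero]; exact h0
  | add x y _ _ hx hy => rw [map_add]; exact hadd _ _ hx hy
  | smul s x _ hx =>
    rw [Subalgebra.smul_def, LinearMap.map_smulₛₗ, smul_eq_mul]
    exact hmul _ (hS.map_mem s.2) _ hx
  | mem x hx => obtain ⟨j, rfl⟩ := hx; exact hE j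

theorem not_isUnit_two_mul (a : ℤ_[2]) : ¬ IsUnit (2 * a) := by
  rw [isUnit_iff_red, ← ne_eq, map_mul, map_ofNat]
  generalize red a = r
  revert r; decide

theorem isUnit_add_two_mul {a : ℤ_[2]} (ha : IsUnit a) (b : ℤ_[2]) : IsUnit (a + 2 * b) := by
  rw [isUnit_iff_red] at *
  rw [map_add, map_mul, map_ofNat]
  generalize red a = r at *
  generalize red b = s
  revert r s; decide

/-- If all lengths are even, some entry `h (b 0) (b j) = x + yθ` is outside `2S`, as the row
generates the unit ideal. Replacing `b 0` by `b 0 + λ b j` changes the length by `Tr(σ(λ)(x + yθ))`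
modulo `2`. This is `y` for `λ = 1` and `x` for `λ = θ`, so one choice gives an odd length. -/
theorem IsUnimodularFamily.exists_pivot_of_trace_one (hS : IsQuadOrder σ S 1 n θ)
    (hh : ∀ v w, h v w = σ (h w v)) {b : Fin (m + 1) → V} (hb : IsUnimodularFamily S h b) :
    ∃ b' : Fin (m + 1) → V, IsUnimodularFamily S h b' ∧
      Submodule.span S (Set.range b') = Submodule.span S (Set.range b) ∧
      ∃ i a, IsUnit a ∧ h (b' i) (b' i) = ι a := by
  by_cases hex : ∃ i a, IsUnit a ∧ h (b i) (b i) = ι a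
  · exact ⟨b, hb, rfl, hex⟩
  have hdiag : ∀ i, ∃ a, h (b i) (b i) = ι (2 * a) := by
    intro i
    obtain ⟨a, ha⟩ := hb.exists_length hS hh (v := b i) (Submodule.subset_span ⟨i, rfl⟩)
    rcases isUnit_or_two_dvd a with hu | ⟨c, rfl⟩
    · exact absurd ⟨i, a, hu, ha⟩ hex
    · exact ⟨c, ha⟩
  obtain ⟨j, hj⟩ : ∃ j, ¬ ∃ x y : ℤ_[2], h (b 0) (b j) = ι (2 * x) + ι (2 * y) * θ := by
    by_contra hcon
    push Not at hcon
    obtain ⟨x, y, hxy⟩ := hb.row_induction hS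
      (fun z => ∃ x y : ℤ_[2], z = ι (2 * x) + ι (2 * y) * θ) ⟨0, 0, by simp⟩
      (by
        rintro _ _ ⟨x, y, rfl⟩ ⟨x', y', rfl⟩
        exact ⟨x + x', y + y', by simp only [map_mul, map_add]; ring⟩)
      (by
        rintro s hs _ ⟨x, y, rfl⟩
        obtain ⟨u, v, rfl⟩ := (hS.mem_iff s).1 hs
        refine ⟨u * x - n * v * y, u * y + v * x + v * y, ?_⟩
        have := hS.gen_mul_gen
        simp only [map_mul, map_add, map_sub, map_one, one_mul] at this ⊢
        linear_combination ι v * ι 2 * ι y * this)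
      hcon
    have := (hS.elt_inj (x := 1) (y := 0) (x' := 2 * x) (y' := 2 * y) (by simpa using hxy)).1
    exact not_isUnit_two_mul x (this ▸ isUnit_one)
  have hj0 : (0 : Fin (m + 1)) ≠ j := by
    rintro rfl
    obtain ⟨a, ha⟩ := hdiag 0
    exact hj ⟨a, 0, by simp [ha]⟩
  obtain ⟨a₀, ha₀⟩ := hdiag 0
  obtain ⟨a₁, ha₁⟩ := hdiag j
  obtain ⟨x, y, hxy⟩ := (hS.mem_iff _).1 (hb.integral 0 j)
  have hyx : h (b j) (b 0) = ι (x + y) + ι (-y) * θ := by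
    rw [hh, hxy, hS.map_elt, one_mul]
  have key : ∀ p q : ℤ_[2], ∃ z, h (b 0 + (ι p + ι q * θ) • b j) (b 0 + (ι p + ι q * θ) • b j) =
      ι (2 * z + (p * y + q * x)) := by
    intro p q
    refine ⟨a₀ + a₁ * normForm 1 n p q + x * p + n * q * y, ?_⟩
    have hN := hS.elt_mul_map p q
    have hg := hS.gen_mul_gen
    simp only [map_add, map_smul, LinearMap.add_apply, LinearMap.smul_apply, smul_eq_mul,
      LinearMap.map_smulₛₗ, ha₀, ha₁, hyx, hxy, map_mul, hS.map_algebraMap, hS.map_gen, map_neg,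
      map_one, one_mul, map_ofNat] at hN hg ⊢
    linear_combination 2 * ι a₁ * hN - 2 * ι q * ι y * hg
  have fin : ∀ p q : ℤ_[2], IsUnit (p * y + q * x) → ∃ b' : Fin (m + 1) → V,
      IsUnimodularFamily S h b' ∧
      Submodule.span S (Set.range b') = Submodule.span S (Set.range b) ∧
      ∃ i a, IsUnit a ∧ h (b' i) (b' i) = ι a := by
    intro p q hu
    obtain ⟨z, hz⟩ := key p q
    refine ⟨_, hb.update_add hS hj0 (hS.elt_mem p q),
      span_range_update_add hj0 (hS.elt_mem p q), 0,
      2 * z + (p * y + q * x), ?_, ?_⟩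
    · rw [add_comm]
      exact isUnit_add_two_mul hu z
    · rw [Function.update_self]
      exact hz
  rcases isUnit_or_two_dvd y with hy | ⟨y', rfl⟩
  · exact fin 1 0 (by simpa using hy)
  · rcases isUnit_or_two_dvd x with hx | ⟨x', rfl⟩
    · exact fin 0 1 (by simpa using hx)
    · exact absurd ⟨x', y', hxy⟩ hj

/-- For `t = 0` all traces from `S` are even, so length modulo `2` is additive and vectors of even
length form a submodule. An odd vector in the span thus forces an odd member of the family. -/
theorem IsUnimodularFamily.exists_pivot_of_trace_zero (hS : IsQuadOrder σ S 0 n θ)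
    (hh : ∀ v w, h v w = σ (h w v)) {b : Fin m → V} (hb : IsUnimodularFamily S h b)
    {v : V} (hv : v ∈ Submodule.span S (Set.range b)) {a : ℤ_[2]} (ha : h v v = ι a)
    (hu : IsUnit a) : ∃ i a, IsUnit a ∧ h (b i) (b i) = ι a := by
  by_contra hex
  have hdiag : ∀ i, ∃ a, h (b i) (b i) = ι (2 * a) := by
    intro i
    obtain ⟨a, ha⟩ := hb.exists_length hS hh (v := b i) (Submodule.subset_span ⟨i, rfl⟩)
    rcases isUnit_or_two_dvd a with hu | ⟨c, rfl⟩
    · exact absurd ⟨i, a, hu, ha⟩ hex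
    · exact ⟨c, ha⟩
  have hall : ∃ a, h v v = ι (2 * a) := by
    clear ha
    induction hv using Submodule.span_induction with
    | zero => exact ⟨0, by simp⟩
    | add x y hx hy ihx ihy =>
      obtain ⟨a₁, h₁⟩ := ihx
      obtain ⟨a₂, h₂⟩ := ihy
      obtain ⟨p, q, hpq⟩ := (hS.mem_iff _).1 (hb.form_mem hS hx hy)
      refine ⟨a₁ + a₂ + p, ?_⟩
      have h3 := hS.elt_add_map p q
      rw [← hpq, ← hh y x] at h3
      simp only [map_add, LinearMap.add_apply, h₁, h₂, map_mul, zero_mul, map_zero] at h3 ⊢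
      linear_combination h3
    | smul s x _ ih =>
      obtain ⟨a₁, h₁⟩ := ih
      obtain ⟨c, hc⟩ := hS.exists_norm s.2
      refine ⟨a₁ * c, ?_⟩
      simp only [Subalgebra.smul_def, map_smul, LinearMap.smul_apply, smul_eq_mul,
        LinearMap.map_smulₛₗ, h₁, map_mul]
      linear_combination ι 2 * ι a₁ * hc
    | mem x hx => obtain ⟨j, rfl⟩ := hx; exact hdiag j
  obtain ⟨c, hc⟩ := hall
  exact not_isUnit_two_mul c (hS.injective (hc.symm.trans ha) ▸ hu)

/-- Since `N(x + y) = N(x) + N(y) + Tr(x σ(y))` with an even trace, the elements of even norm form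
an ideal. It is proper, so it cannot contain a whole row of the Gram matrix. -/
theorem IsUnimodularFamily.exists_unit_entry (hS : IsQuadOrder σ S 0 n θ)
    {b : Fin (m + 1) → V} (hb : IsUnimodularFamily S h b) :
    ∃ i j a, IsUnit a ∧ h (b i) (b j) * σ (h (b i) (b j)) = ι a := by
  by_contra hex
  have hE : ∀ j, ∃ a, h (b 0) (b j) * σ (h (b 0) (b j)) = ι (2 * a) := by
    intro j
    obtain ⟨a, ha⟩ := hS.exists_norm (hb.integral 0 j)
    rcases isUnit_or_two_dvd a with hu | ⟨c, rfl⟩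
    · exact absurd ⟨0, j, a, hu, ha⟩ hex
    · exact ⟨c, ha⟩
  obtain ⟨-, a, ha⟩ := hb.row_induction hS (fun z => z ∈ S ∧ ∃ a, z * σ z = ι (2 * a))
    ⟨S.zero_mem, 0, by simp⟩
    (by
      rintro x y ⟨hx, a₁, h₁⟩ ⟨hy, a₂, h₂⟩
      obtain ⟨p, q, hpq⟩ := (hS.mem_iff _).1 (S.mul_mem hx (hS.map_mem hy))
      have hσσ := hS.map_map hy
      refine ⟨S.add_mem hx hy, a₁ + a₂ + p, ?_⟩
      have h3 := hS.elt_add_map p q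
      rw [← hpq, map_mul, hσσ] at h3
      simp only [map_add, map_mul, zero_mul, map_zero] at h₁ h₂ h3 ⊢
      linear_combination h₁ + h₂ + h3)
    (by
      rintro s hs x ⟨hx, a₁, h₁⟩
      obtain ⟨c, hc⟩ := hS.exists_norm hs
      refine ⟨S.mul_mem hs hx, c * a₁, ?_⟩
      simp only [map_mul] at h₁ ⊢
      linear_combination s * σ s * h₁ + ι 2 * ι a₁ * hc)
    (fun j => ⟨hb.integral 0 j, hE j⟩)
  rw [map_one, mul_one, ← map_one ι] at ha
  exact not_isUnit_two_mul a (hS.injective ha ▸ isUnit_one)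

/-- An odd unimodular lattice has an orthogonal basis. -/
theorem IsUnimodularFamily.exists_hasOrth (hS : IsQuadOrder σ S t n θ)
    (hh : ∀ v w, h v w = σ (h w v)) (m : ℕ) : ∀ (b : Fin m → V), IsUnimodularFamily S h b →
    (m = 0 ∨ ∃ v ∈ Submodule.span S (Set.range b), ∃ a, IsUnit a ∧ h v v = ι a) →
    ∃ l : List ℤ_[2], l.length = m ∧ (∀ a ∈ l, IsUnit a) ∧
      HasOrth S h (Submodule.span S (Set.range b)) l := by
  induction m with
  | zero =>
    intro b _ _
    exact ⟨[], rfl, by simp, [], .nil, .nil, by simp⟩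
  | succ m ih =>
    -- splitting off a vector of unit length whose complement is odd
    have split : ∀ (b b' : Fin (m + 1) → V), IsUnimodularFamily S h b' →
        Submodule.span S (Set.range b') = Submodule.span S (Set.range b) →
        ∀ p a e, IsUnit a → h (b' p) (b' p) = ι a → a * e = 1 →
        (m = 0 ∨ ∃ v ∈ Submodule.span S (Set.range (complFamily h b' p e)),
          ∃ a, IsUnit a ∧ h v v = ι a) →
        ∃ l : List ℤ_[2], l.length = m + 1 ∧ (∀ a ∈ l, IsUnit a) ∧
          HasOrth S h (Submodule.span S (Set.range b)) l := by
      intro b b' hb' hspan p a e hu ha hae hodd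
      obtain ⟨l, hl, hlu, hl'⟩ := ih _ (hb'.compl hS hh ha hae) hodd
      refine ⟨a :: l, by rw [List.length_cons, hl], List.forall_mem_cons.2 ⟨hu, hlu⟩, ?_⟩
      rw [← hspan]
      exact hl'.of_complFamily hh hb' ha hae
    intro b hb hodd
    rcases hS.trace_eq with rfl | rfl
    · obtain ⟨v, hv, a, hu, ha⟩ := hodd.resolve_left (by omega)
      obtain ⟨p, a, hu, ha⟩ := hb.exists_pivot_of_trace_zero hS hh hv ha hu
      obtain ⟨e, hae⟩ := hu.exists_right_inv
      have hc := hb.compl hS hh ha hae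
      by_cases hodd' : m = 0 ∨ ∃ v ∈ Submodule.span S (Set.range (complFamily h b p e)),
          ∃ a, IsUnit a ∧ h v v = ι a
      · exact split b b hb rfl p a e hu ha hae hodd'
      push Not at hodd'
      obtain ⟨hm, heven⟩ := hodd'
      obtain ⟨k, rfl⟩ := Nat.exists_eq_succ_of_ne_zero hm
      -- The complement of `b p` is even, so the pivot must be changed: `b p + B j` still has odd
      -- length `a + 2α`. Projecting `B i` off it yields length `2β - N(h(B i, B j)) / (a + 2α)`,
      -- which is odd because `h(B i, B j)` has unit norm `c`. The new complement is therefore odd.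
      obtain ⟨i, j, c, hcu, hc'⟩ := hc.exists_unit_entry hS
      set B := complFamily h b p e with hB
      have hdiag : ∀ i, ∃ a, h (B i) (B i) = ι (2 * a) := by
        intro i
        have hi : B i ∈ Submodule.span S (Set.range B) := Submodule.subset_span ⟨i, rfl⟩
        obtain ⟨a, ha⟩ := hc.exists_length hS hh hi
        rcases isUnit_or_two_dvd a with hu | ⟨c, rfl⟩
        · exact absurd ha (heven _ hi a hu)
        · exact ⟨c, ha⟩
      have horth : ∀ j, h (B j) (b p) = 0 := complFamily_orth ha hae
      have horth' : ∀ j, h (b p) (B j) = 0 := fun j => by rw [hh, horth, map_zero]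
      have hcons := hc.cons hS hh ha hu horth
      set C : Fin (k.succ + 1) → V := Fin.cons (b p) B with hC
      have hspanC : Submodule.span S (Set.range C) = Submodule.span S (Set.range b) := by
        rw [hC, Fin.range_cons, Submodule.span_insert, span_complFamily hb p e]
      have h0i : (0 : Fin (k.succ + 1)) ≠ j.succ := (Fin.succ_ne_zero j).symm
      have hD := hcons.update_add hS h0i S.one_mem
      have hspanD := (span_range_update_add (b := C) h0i S.one_mem).trans hspanC
      set D := Function.update C 0 (C 0 + (1 : K) • C j.succ) with hD'
      have hD0 : D 0 = b p + B j := by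
        rw [hD', Function.update_self, one_smul]
        rfl
      have hDs : ∀ l : Fin k.succ, D l.succ = B l := by
        intro l
        rw [hD', Function.update_of_ne (Fin.succ_ne_zero l)]
        rfl
      obtain ⟨α, hα⟩ := hdiag j
      obtain ⟨β, hβ⟩ := hdiag i
      have hD00 : h (D 0) (D 0) = ι (a + 2 * α) := by
        rw [hD0]
        simp only [map_add, LinearMap.add_apply, ha, hα, horth, horth', map_mul]
        ring
      have hu' : IsUnit (a + 2 * α) := isUnit_add_two_mul hu α
      obtain ⟨e', hae'⟩ := hu'.exists_right_inv
      refine split b D hD hspanD 0 _ e' hu' hD00 hae' (.inr ⟨complFamily h D 0 e' i,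
        Submodule.subset_span ⟨i, rfl⟩, -(c * e') + 2 * β, ?_, ?_⟩)
      · exact isUnit_add_two_mul (hcu.mul (IsUnit.of_mul_eq_one_right _ hae')).neg β
      · have hz : h (D (Fin.succAbove 0 i)) (D 0) = h (B i) (B j) := by
          rw [Fin.succAbove_zero, hDs, hD0, map_add, horth, zero_add]
        have hz' : h (D 0) (D (Fin.succAbove 0 i)) = σ (h (B i) (B j)) := by rw [hh, hz]
        have hz2 : h (D (Fin.succAbove 0 i)) (D (Fin.succAbove 0 i)) = ι (2 * β) := by
          rw [Fin.succAbove_zero, hDs, hβ]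
        have hae2 : ι (a + 2 * α) * ι e' = 1 := by rw [← map_mul, hae', map_one]
        simp only [complFamily, map_sub, map_smul, LinearMap.sub_apply, LinearMap.smul_apply,
          LinearMap.map_smulₛₗ, smul_eq_mul, hz, hz', hz2, hD00, map_mul (σ), hS.map_algebraMap]
        rw [map_add ι (-(c * e')), map_neg, map_mul ι c, ← hc']
        linear_combination ι e' * h (B i) (B j) * σ (h (B i) (B j)) * hae2
    -- For trace one every nonempty unimodular family is odd, so any pivot works.
    · obtain ⟨b', hb', hspan, p, a, hu, ha⟩ := hb.exists_pivot_of_trace_one hS hh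
      obtain ⟨e, hae⟩ := hu.exists_right_inv
      refine split b b' hb' hspan p a e hu ha hae ?_
      cases m with
      | zero => exact .inl rfl
      | succ k =>
        right
        obtain ⟨b'', -, hspan', i, a', hu', ha'⟩ :=
          (hb'.compl hS hh ha hae).exists_pivot_of_trace_one hS hh
        exact ⟨b'' i, hspan' ▸ Submodule.subset_span ⟨i, rfl⟩, a', hu', ha'⟩

end Diagonalization

/-! ### The completion of an order -/

/-- An order in a quadratic field is `ℤ ⊕ ℤ θ` with `θ` of trace `0` or `1`. -/
theorem IsOrder.exists_gen {d : ℤ} {R : Subring (QuadField d)} (hR : IsOrder R) :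
    ∃ (θ : QuadField d) (t n : ℤ), θ ∈ R ∧ (∀ z ∈ R, ∃ x y : ℤ, z = x + y * θ) ∧
      θ.im ≠ 0 ∧ (t = 0 ∨ t = 1) ∧ θ * θ = t * θ - n ∧ star θ = t - θ := by
  have := hR.free
  have hfin : Module.Finite ℤ R := Module.finite_of_finrank_pos (by rw [hR.rank]; norm_num)
  let e : Module.Basis (Fin 2) ℤ R := Module.finBasisOfFinrankEq ℤ R hR.rank
  have hsum : ∀ r : R, r = e.repr r 0 • e 0 + e.repr r 1 • e 1 := fun r => by
    conv_lhs => rw [← e.sum_repr r, Fin.sum_univ_two]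
  obtain ⟨α, β, hαβ⟩ : ∃ α β : ℤ, (1 : R) = α • e 0 + β • e 1 := ⟨_, _, hsum 1⟩
  -- The element `1` is primitive in `R`: if `1 = c r`, then `e 0 = c (r e 0)`, and comparing
  -- coordinates at `e 0` shows that `c` divides `1`.
  have hcop : IsCoprime α β := by
    rw [Int.isCoprime_iff_gcd_eq_one]
    obtain ⟨α', hα⟩ := Int.gcd_dvd_left (a := α) (b := β)
    obtain ⟨β', hβ⟩ := Int.gcd_dvd_right (a := α) (b := β)
    set c : ℕ := Int.gcd α β with hc
    have h1 : (1 : R) = (c : ℤ) • (α' • e 0 + β' • e 1) := by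
      rw [hαβ, hα, hβ, smul_add, mul_smul, mul_smul]
    have h2 : e 0 = (c : ℤ) • ((α' • e 0 + β' • e 1) * e 0) := by
      rw [← smul_mul_assoc, ← h1, one_mul]
    have h3 : e.repr (e 0) 0 = (c : ℤ) * e.repr ((α' • e 0 + β' • e 1) * e 0) 0 := by
      conv_lhs => rw [h2]
      rw [map_zsmul]
      rfl
    rw [e.repr_self, Finsupp.single_eq_same] at h3
    exact Int.natCast_inj.1 (Int.eq_one_of_mul_eq_one_right (by positivity) h3.symm)
  obtain ⟨p, q, hpq⟩ := hcop
  -- a complement of `1`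
  let η : R := (-q) • e 0 + p • e 1
  have he0 : e 0 = p • (1 : R) - β • η := by
    have : e 0 = (p * α + q * β) • e 0 := by rw [hpq, one_smul]
    rw [this, hαβ]
    module
  have he1 : e 1 = q • (1 : R) + α • η := by
    have : e 1 = (p * α + q * β) • e 1 := by rw [hpq, one_smul]
    rw [this, hαβ]
    module
  have hspan : ∀ r : R, ∃ x y : ℤ, r = x • (1 : R) + y • η := by
    intro r
    refine ⟨e.repr r 0 * p + e.repr r 1 * q, -(e.repr r 0 * β) + e.repr r 1 * α, ?_⟩
    conv_lhs => rw [hsum r, he0, he1]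
    module
  have hspan' : ∀ z ∈ R, ∃ x y : ℤ, z = x + y * (η : QuadField d) := by
    intro z hz
    obtain ⟨x, y, hxy⟩ := hspan ⟨z, hz⟩
    refine ⟨x, y, ?_⟩
    have := congrArg (fun r : R => (r : QuadField d)) hxy
    simpa [zsmul_eq_mul] using this
  -- A rational `η = N/D` would satisfy `D η = N · 1`, contradicting the independence of `1` and
  -- `η`, whose coordinates have determinant `pα + qβ = 1`.
  have him : (η : QuadField d).im ≠ 0 := by
    intro h0
    have hq : ((η : QuadField d).re.den : ℤ) • η = (η : QuadField d).re.num • (1 : R) := by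
      apply Subtype.ext
      rw [AddSubgroupClass.coe_zsmul, AddSubgroupClass.coe_zsmul, zsmul_eq_mul, zsmul_eq_mul]
      ext
      · simp
      · simp [h0]
    set D := (η : QuadField d).re.den with hD
    set N := (η : QuadField d).re.num with hN
    have hrep := fun i => congrArg (fun r => e.repr r i) hq
    rw [hαβ] at hrep
    have r0 := hrep 0
    have r1 := hrep 1
    simp only [η, map_add, map_smul, Finsupp.add_apply, Finsupp.smul_apply, e.repr_self,
      Finsupp.single_apply, smul_eq_mul, Fin.isValue, zero_ne_one, one_ne_zero, if_true, if_false,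
      mul_one, mul_zero, add_zero, zero_add] at r0 r1
    have : (D : ℤ) = 0 := by
      linear_combination (-(D : ℤ)) * hpq + α * r1 - β * r0
    exact (η : QuadField d).re.den_nz (by exact_mod_cast this)
  obtain ⟨x, y, hxy⟩ := hspan' _ (R.mul_mem η.2 η.2)
  have hy : (y : ℚ) = 2 * (η : QuadField d).re := by
    have h1 := congrArg QuadraticAlgebra.im hxy
    simp at h1
    have h2 : (y - 2 * (η : QuadField d).re) * (η : QuadField d).im = 0 := by
      linear_combination -h1
    linear_combination (mul_eq_zero.1 h2).resolve_right him
  -- The trace of `η` is `y`. Subtracting `k = ⌊y/2⌋` leaves the trace `y mod 2`, and the norm of `η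
  -- - k` is read off from `η² = x + yη`.
  have hk : y % 2 = y - 2 * (y / 2) := by omega
  generalize y / 2 = k at hk
  refine ⟨η - k, y % 2, -((y - 2 * k) * k + x + k ^ 2), R.sub_mem η.2 (intCast_mem R k), ?_, ?_,
    Int.emod_two_eq_zero_or_one y, ?_, ?_⟩
  · intro z hz
    obtain ⟨a, b, rfl⟩ := hspan' z hz
    exact ⟨a + b * k, b, by push_cast; ring⟩
  · simpa using him
  · rw [hk]
    push_cast
    linear_combination hxy
  · rw [hk]
    ext
    · simp [QuadraticAlgebra.re_ofNat]
      linear_combination -hy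
    · simp [QuadraticAlgebra.im_ofNat]

theorem algebraMap_padicInt_apply {d : ℤ} (a : ℤ_[2]) :
    algebraMap ℤ_[2] (QuadField₂ d) a = (a : ℚ_[2]) ⊗ₜ 1 := rfl

theorem conj₂_tmul {d : ℤ} (x : ℚ_[2]) (z : QuadField d) :
    conj₂ d (x ⊗ₜ z) = x ⊗ₜ star z := rfl

/-- Elements of `F₂` have unique coordinates with respect to `1, θ`. -/
theorem tmul_add_tmul_eq_zero {d : ℤ} {θ : QuadField d} (hθ : θ.im ≠ 0) {x y : ℚ_[2]}
    (h : x ⊗ₜ[ℚ] (1 : QuadField d) + y ⊗ₜ[ℚ] θ = 0) : x = 0 ∧ y = 0 := by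
  -- Every linear functional on `F` extends to `F₂`; the two coordinate functionals then separate
  -- `x` and `y`.
  have hre : ∀ (f : QuadField d →ₗ[ℚ] ℚ), x * (f 1 : ℚ_[2]) + y * (f θ : ℚ_[2]) = 0 := by
    intro f
    have := congrArg (TensorProduct.rid ℚ ℚ_[2] ∘ (f.lTensor ℚ_[2])) h
    simpa [Rat.smul_def, mul_comm] using this
  have h1 := hre (QuadraticAlgebra.imₗ _ _)
  have h2 := hre (QuadraticAlgebra.reₗ _ _)
  have hθ' : (θ.im : ℚ_[2]) ≠ 0 := by exact_mod_cast hθ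
  simp [QuadraticAlgebra.imₗ, QuadraticAlgebra.reₗ, hθ', QuadraticAlgebra.re_one,
    QuadraticAlgebra.im_one] at h1 h2
  subst h1
  simpa using h2

theorem exists_tmul_add_tmul {d : ℤ} {θ : QuadField d} (hθ : θ.im ≠ 0) (z : QuadField₂ d) :
    ∃ x y : ℚ_[2], z = x ⊗ₜ[ℚ] (1 : QuadField d) + y ⊗ₜ[ℚ] θ := by
  induction z using TensorProduct.induction_on with
  | zero => exact ⟨0, 0, by simp⟩
  | add z w hz hw =>
    obtain ⟨x, y, rfl⟩ := hz
    obtain ⟨x', y', rfl⟩ := hw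
    exact ⟨x + x', y + y', by rw [TensorProduct.add_tmul, TensorProduct.add_tmul]; abel⟩
  | tmul x z =>
    have hz : z = (z.re - z.im / θ.im * θ.re) • (1 : QuadField d) + (z.im / θ.im) • θ := by
      ext
      · simp [QuadraticAlgebra.re_one]
      · simp [hθ, QuadraticAlgebra.im_one]
    refine ⟨(z.re - z.im / θ.im * θ.re) • x, (z.im / θ.im) • x, ?_⟩
    conv_lhs => rw [hz]
    rw [TensorProduct.tmul_add, TensorProduct.tmul_smul, TensorProduct.tmul_smul,
      TensorProduct.smul_tmul', TensorProduct.smul_tmul']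

theorem completionMap_tmul {d : ℤ} (R : Subring (QuadField d)) (a : ℤ_[2]) (r : R) :
    completionMap R (a ⊗ₜ r) = (a : ℚ_[2]) ⊗ₜ[ℚ] (r : QuadField d) := by
  rw [completionMap, Algebra.TensorProduct.lift_tmul]
  change ((a : ℚ_[2]) ⊗ₜ[ℚ] (1 : QuadField d)) * ((1 : ℚ_[2]) ⊗ₜ[ℚ] (r : QuadField d)) = _
  rw [Algebra.TensorProduct.tmul_mul_tmul, mul_one, one_mul]

/-- The completion of an order is a quadratic order over `ℤ₂`. -/
theorem IsOrder.exists_isQuadOrder {d : ℤ} {R : Subring (QuadField d)} (hR : IsOrder R) :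
    ∃ (θ : QuadField d) (t n : ℤ_[2]), θ.im ≠ 0 ∧
      IsQuadOrder (conj₂ d) (completion₂ R) t n ((1 : ℚ_[2]) ⊗ₜ[ℚ] θ) := by
  obtain ⟨θ, t, n, hθR, hspan, him, ht, hmul, hstar⟩ := hR.exists_gen
  have hint : ∀ k : ℤ, algebraMap ℤ_[2] (QuadField₂ d) k = (1 : ℚ_[2]) ⊗ₜ (k : QuadField d) := by
    intro k
    rw [map_intCast, ← Int.cast_one (R := ℚ_[2])]
    exact (map_intCast (Algebra.TensorProduct.includeRight :
      QuadField d →ₐ[ℚ] QuadField₂ d) k).symm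
  have helt : ∀ x y : ℤ_[2], algebraMap ℤ_[2] (QuadField₂ d) x +
      algebraMap ℤ_[2] (QuadField₂ d) y * ((1 : ℚ_[2]) ⊗ₜ[ℚ] θ) =
      (x : ℚ_[2]) ⊗ₜ 1 + (y : ℚ_[2]) ⊗ₜ θ := by
    intro x y
    rw [algebraMap_padicInt_apply, algebraMap_padicInt_apply,
      Algebra.TensorProduct.tmul_mul_tmul, mul_one, one_mul]
  refine ⟨θ, t, n, him, ?_, ?_, ?_, ?_, ?_, ?_⟩
  · intro a
    rw [algebraMap_padicInt_apply, conj₂_tmul, star_one]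
  · rw [conj₂_tmul, hstar, hint, TensorProduct.tmul_sub]
  · rw [hint, hint, Algebra.TensorProduct.tmul_mul_tmul, Algebra.TensorProduct.tmul_mul_tmul,
      mul_one, hmul, TensorProduct.tmul_sub]
  · intro z
    constructor
    · rintro ⟨w, rfl⟩
      induction w using TensorProduct.induction_on with
      | zero => exact ⟨0, 0, by simp⟩
      | add z w hz hw =>
        obtain ⟨x, y, hz⟩ := hz
        obtain ⟨x', y', hw⟩ := hw
        refine ⟨x + x', y + y', ?_⟩
        rw [map_add, hz, hw, map_add, map_add]
        ring
      | tmul a r =>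
        obtain ⟨x, y, hxy⟩ := hspan r r.2
        refine ⟨a * x, a * y, ?_⟩
        have hk : ∀ k : ℤ, (k : QuadField d) = (k : ℚ) • (1 : QuadField d) := fun k => by
          rw [Int.cast_smul_eq_zsmul, zsmul_one]
        refine (completionMap_tmul R a r).trans ?_
        rw [helt, hxy, hk, hk, smul_mul_assoc, one_mul, TensorProduct.tmul_add,
          TensorProduct.tmul_smul, TensorProduct.tmul_smul, TensorProduct.smul_tmul',
          TensorProduct.smul_tmul']
        simp [Rat.smul_def, mul_comm]
    · rintro ⟨x, y, rfl⟩
      rw [helt]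
      refine ⟨x ⊗ₜ 1 + y ⊗ₜ ⟨θ, hθR⟩, ?_⟩
      exact (map_add (completionMap R) _ _).trans
        (congrArg₂ _ (completionMap_tmul R x 1) (completionMap_tmul R y ⟨θ, hθR⟩))
  · intro x y hxy
    rw [helt] at hxy
    have := tmul_add_tmul_eq_zero him hxy
    exact this.imp PadicInt.coe_eq_zero.1 PadicInt.coe_eq_zero.1
  · rcases ht with rfl | rfl <;> simp

/-! ### Norm groups and maximality -/

section NormGroup

variable {d : ℤ} {S : Subalgebra ℤ_[2] (QuadField₂ d)} {t n : ℤ_[2]} {θ : QuadField₂ d}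

/-- An element of `S` is invertible exactly when its norm is a unit of `ℤ₂`, so the norm group is
the set of unit values of the norm form. -/
theorem IsQuadOrder.mem_normGroup_iff (hS : IsQuadOrder (conj₂ d) S t n θ) (a : ℤ_[2]) :
    a ∈ normGroup S ↔ IsUnit a ∧ ∃ x y, a = normForm t n x y := by
  constructor
  · rintro ⟨r, hr⟩
    obtain ⟨x, y, hxy⟩ := (hS.mem_iff _).1 (r : S).2
    obtain ⟨x', y', hxy'⟩ := (hS.mem_iff _).1 ((r⁻¹ : Sˣ) : S).2
    have hr' : ((r : S) : QuadField₂ d) * (((r⁻¹ : Sˣ) : S) : QuadField₂ d) = 1 := by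
      rw [← S.coe_mul, Units.mul_inv, S.coe_one]
    have ha : a = normForm t n x y := hS.injective (by rw [hr, hxy, hS.elt_mul_map])
    have h1 : a * normForm t n x' y' = 1 := by
      apply hS.injective
      rw [map_mul, hr, ← hS.elt_mul_map, ← hxy', map_one, mul_mul_mul_comm, hr', ← map_mul, hr',
        map_one, one_mul]
    exact ⟨IsUnit.of_mul_eq_one _ h1, x, y, ha⟩
  · rintro ⟨hu, x, y, rfl⟩
    obtain ⟨s, hs, hs'⟩ := hS.exists_inv (hS.elt_mem x y) (hS.elt_mul_map x y) hu
    refine ⟨⟨⟨_, hS.elt_mem x y⟩, ⟨s, hs⟩, Subtype.ext hs',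
      Subtype.ext ((mul_comm _ _).trans hs')⟩, ?_⟩
    exact (hS.elt_mul_map x y).symm

theorem IsQuadOrder.mem_normGroup_of_red (hS : IsQuadOrder (conj₂ d) S t n θ) {a x y : ℤ_[2]}
    (ha : IsUnit a) (hxy : red (normForm t n x y) = red a) : a ∈ normGroup S := by
  obtain ⟨m, hm⟩ := exists_sq_of_red_eq ha hxy
  refine (hS.mem_normGroup_iff a).2 ⟨ha, m * x, m * y, ?_⟩
  rw [← hm]
  simp only [normForm]
  ring

theorem isUnit_seven : IsUnit (7 : ℤ_[2]) := by
  rw [isUnit_iff_red, map_ofNat]; decide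

end NormGroup

/-! ### Maximality of `S` in terms of `t` and `n` -/

section Maximal

variable {d : ℤ} {S : Subalgebra ℤ_[2] (QuadField₂ d)} {t n : ℤ_[2]} {θ : QuadField d}

theorem exists_of_isIntegral_tmul_one {x : ℚ_[2]}
    (hx : IsIntegral ℤ_[2] (x ⊗ₜ[ℚ] (1 : QuadField d))) : ∃ a : ℤ_[2], (a : ℚ_[2]) = x := by
  have hinj : Function.Injective (algebraMap ℚ_[2] (QuadField₂ d)) := by
    rw [injective_iff_map_eq_zero]
    intro y hy
    have hω : (⟨0, 1⟩ : QuadField d).im ≠ 0 := one_ne_zero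
    refine (tmul_add_tmul_eq_zero (x := y) (y := 0) hω ?_).1
    rw [TensorProduct.zero_tmul, add_zero]
    exact hy
  have h1 : IsIntegral ℤ_[2] (algebraMap ℚ_[2] (QuadField₂ d) x) := hx
  rw [isIntegral_algebraMap_iff hinj] at h1
  exact IsIntegrallyClosed.isIntegral_iff.1 h1

theorem isIntegral_conj₂ (hS : IsQuadOrder (conj₂ d) S t n ((1 : ℚ_[2]) ⊗ₜ[ℚ] θ))
    {z : QuadField₂ d} (hz : IsIntegral ℤ_[2] z) : IsIntegral ℤ_[2] (conj₂ d z) :=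
  hz.map (⟨conj₂ d, hS.map_algebraMap⟩ : QuadField₂ d →ₐ[ℤ_[2]] QuadField₂ d)

/-- The order `ℤ₂[√-n]` with `n ≡ 1 mod 4` is maximal. -/
theorem IsQuadOrder.isMaximalOrder (hθ : θ.im ≠ 0)
    (hS : IsQuadOrder (conj₂ d) S 0 n ((1 : ℚ_[2]) ⊗ₜ[ℚ] θ)) (hn : 2 * red n = 2) :
    IsMaximalOrder S := by
  have hmul := hS.gen_mul_gen
  rw [map_zero, zero_mul, zero_sub] at hmul
  have hconj := hS.map_gen
  rw [map_zero, zero_sub] at hconj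
  apply le_antisymm
  · intro z hz
    obtain ⟨x, y, rfl⟩ := (hS.mem_iff z).1 hz
    rw [mem_integralClosure_iff]
    have hθi : IsIntegral ℤ_[2] ((1 : ℚ_[2]) ⊗ₜ[ℚ] θ) := by
      refine IsIntegral.of_pow (n := 2) (by norm_num) ?_
      rw [pow_two, hmul, ← map_neg]
      exact isIntegral_algebraMap
    exact isIntegral_algebraMap.add (isIntegral_algebraMap.mul hθi)
  · intro z hz
    rw [mem_integralClosure_iff] at hz
    obtain ⟨x, y, rfl⟩ := exists_tmul_add_tmul hθ z
    have hz' := isIntegral_conj₂ hS hz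
    have hyθ : y ⊗ₜ[ℚ] θ = (y ⊗ₜ[ℚ] (1 : QuadField d)) * ((1 : ℚ_[2]) ⊗ₜ[ℚ] θ) := by
      rw [Algebra.TensorProduct.tmul_mul_tmul, mul_one, one_mul]
    have hc : ∀ w : ℚ_[2], conj₂ d (w ⊗ₜ 1) = w ⊗ₜ 1 := fun w => by
      rw [conj₂_tmul, star_one]
    rw [map_add, hyθ, map_mul, hc, hc, hconj] at hz'
    rw [hyθ] at hz
    have hprod : ∀ w v : ℚ_[2], (w ⊗ₜ[ℚ] (1 : QuadField d)) * (v ⊗ₜ 1) = (w * v) ⊗ₜ 1 :=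
      fun w v => by rw [Algebra.TensorProduct.tmul_mul_tmul, mul_one]
    -- For integral `x + yθ` the trace `α = 2x` and the norm `γ = x² + ny²` lie in `ℤ₂`. As `n` is a
    -- unit, `(2y)² = (4γ - α²)/n` makes `β = 2y` integral as well.
    obtain ⟨α, hα⟩ : ∃ α : ℤ_[2], (α : ℚ_[2]) = x + x := by
      apply exists_of_isIntegral_tmul_one (d := d)
      have heq : (x + x) ⊗ₜ[ℚ] (1 : QuadField d) =
          (x ⊗ₜ 1 + (y ⊗ₜ 1) * ((1 : ℚ_[2]) ⊗ₜ[ℚ] θ)) +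
          (x ⊗ₜ 1 + (y ⊗ₜ 1) * -((1 : ℚ_[2]) ⊗ₜ[ℚ] θ)) := by
        rw [TensorProduct.add_tmul]
        ring
      rw [heq]
      exact hz.add hz'
    obtain ⟨γ, hγ⟩ : ∃ γ : ℤ_[2], (γ : ℚ_[2]) = x * x + n * (y * y) := by
      apply exists_of_isIntegral_tmul_one (d := d)
      have heq : (x * x + n * (y * y)) ⊗ₜ[ℚ] (1 : QuadField d) =
          (x ⊗ₜ 1 + (y ⊗ₜ 1) * ((1 : ℚ_[2]) ⊗ₜ[ℚ] θ)) *
          (x ⊗ₜ 1 + (y ⊗ₜ 1) * -((1 : ℚ_[2]) ⊗ₜ[ℚ] θ)) := by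
        rw [TensorProduct.add_tmul, ← hprod, ← hprod, ← hprod, ← algebraMap_padicInt_apply]
        linear_combination (y ⊗ₜ[ℚ] (1 : QuadField d)) * (y ⊗ₜ[ℚ] (1 : QuadField d)) * hmul
      rw [heq]
      exact hz.mul hz'
    have c2 : ((2 : ℤ_[2]) : ℚ_[2]) = 2 := rfl
    have c4 : ((4 : ℤ_[2]) : ℚ_[2]) = 4 := rfl
    have hnu : IsUnit n := by
      rw [isUnit_iff_red]
      generalize red n = r at hn
      revert r; decide
    obtain ⟨e, he⟩ := hnu.exists_left_inv
    have he' : (e : ℚ_[2]) * n = 1 := by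
      rw [← PadicInt.coe_mul, he, PadicInt.coe_one]
    obtain ⟨β, hβ⟩ : ∃ β : ℤ_[2], (β : ℚ_[2]) = y + y := by
      apply IsIntegrallyClosed.isIntegral_iff.1
      refine IsIntegral.of_pow (n := 2) (by norm_num) ?_
      have : (y + y) ^ 2 = algebraMap ℤ_[2] ℚ_[2] (e * (4 * γ - α * α)) := by
        change _ = ((e * (4 * γ - α * α) : ℤ_[2]) : ℚ_[2])
        push_cast
        rw [hα, hγ, c4]
        linear_combination (-4 * y ^ 2) * he'
      rw [this]
      exact isIntegral_algebraMap
    have hrel : α * α + n * (β * β) = 4 * γ := by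
      apply PadicInt.ext
      push_cast
      rw [hα, hβ, hγ, c4]
      ring
    have hrel' := congrArg red hrel
    simp only [map_add, map_mul, map_ofNat] at hrel'
    -- Modulo `4` the relation reads `α² + β² ≡ 0`, so `α` and `β` are even and `x`, `y` are
    -- integral.
    have key : ∀ n a b c : ZMod 8, 2 * n = 2 → a * a + n * (b * b) = 4 * c →
        4 * a = 0 ∧ 4 * b = 0 := by decide
    obtain ⟨h1, h2⟩ := key _ _ _ _ hn hrel'
    obtain ⟨x', rfl⟩ := (two_dvd_iff_red α).2 h1
    obtain ⟨y', rfl⟩ := (two_dvd_iff_red β).2 h2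
    have hx : (x' : ℚ_[2]) = x := by
      rw [PadicInt.coe_mul, c2] at hα
      linear_combination hα / 2
    have hy : (y' : ℚ_[2]) = y := by
      rw [PadicInt.coe_mul, c2] at hβ
      linear_combination hβ / 2
    rw [← hx, hyθ, ← hy, ← algebraMap_padicInt_apply, ← algebraMap_padicInt_apply]
    exact hS.elt_mem x' y'

/-- The order `ℤ₂[√-n]` with `n ≡ 0 mod 4` is not maximal. -/
theorem IsQuadOrder.not_isMaximalOrder
    (hS : IsQuadOrder (conj₂ d) S 0 n ((1 : ℚ_[2]) ⊗ₜ[ℚ] θ)) (hn : 2 * red n = 0) :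
    ¬ IsMaximalOrder S := by
  intro hmax
  have hmul := hS.gen_mul_gen
  rw [map_zero, zero_mul, zero_sub] at hmul
  obtain ⟨k, rfl⟩ : ∃ k, n = 4 * k := by
    obtain ⟨m, hm⟩ := (red_eq_zero_iff (2 * n)).1 (by rw [map_mul, map_ofNat, hn])
    refine ⟨m, ?_⟩
    have h2 : (2 : ℤ_[2]) ≠ 0 := two_ne_zero
    exact mul_left_cancel₀ h2 (by linear_combination hm)
  -- The element `θ/2` has square `-n/4`, so it is integral, but it is not in `S`.
  set z : QuadField₂ d := ((2 : ℚ_[2])⁻¹ ⊗ₜ[ℚ] (1 : QuadField d)) * ((1 : ℚ_[2]) ⊗ₜ[ℚ] θ) with hz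
  have h2z : 2 * ((2 : ℚ_[2])⁻¹ ⊗ₜ[ℚ] (1 : QuadField d)) = 1 := by
    rw [two_mul, ← TensorProduct.add_tmul, Algebra.TensorProduct.one_def]
    congr 1
    norm_num
  have hint : z ∈ S := by
    rw [hmax, mem_integralClosure_iff]
    refine IsIntegral.of_pow (n := 2) (by norm_num) ?_
    have : z ^ 2 = algebraMap ℤ_[2] (QuadField₂ d) (-k) := by
      rw [hz]
      generalize ((2 : ℚ_[2])⁻¹ ⊗ₜ[ℚ] (1 : QuadField d)) = q at h2z
      rw [map_mul, map_ofNat] at hmul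
      rw [map_neg]
      linear_combination q ^ 2 * hmul - algebraMap ℤ_[2] (QuadField₂ d) k * (2 * q + 1) * h2z
    rw [this]
    exact isIntegral_algebraMap
  obtain ⟨x, y, hxy⟩ := (hS.mem_iff z).1 hint
  have h3 : algebraMap ℤ_[2] (QuadField₂ d) (2 * x) +
      algebraMap ℤ_[2] (QuadField₂ d) (2 * y) * ((1 : ℚ_[2]) ⊗ₜ[ℚ] θ) =
      algebraMap ℤ_[2] (QuadField₂ d) 0 +
      algebraMap ℤ_[2] (QuadField₂ d) 1 * ((1 : ℚ_[2]) ⊗ₜ[ℚ] θ) := by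
    rw [hz] at hxy
    simp only [map_mul, map_ofNat, map_zero, map_one, one_mul, zero_add]
    linear_combination (-2) * hxy + ((1 : ℚ_[2]) ⊗ₜ[ℚ] θ) * h2z
  exact not_isUnit_two_mul y ((hS.elt_inj h3).2 ▸ isUnit_one)

/-- The condition of the first part of the classification in terms of trace and norm of the
generator. -/
theorem IsQuadOrder.condition_iff (hθ : θ.im ≠ 0)
    (hS : IsQuadOrder (conj₂ d) S t n ((1 : ℚ_[2]) ⊗ₜ[ℚ] θ)) :
    (IsMaximalOrder S ∨ 3 ∈ normGroup S ∨ 7 ∈ normGroup S) ↔ (t = 1 ∨ 2 * red n ≠ 0) := by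
  constructor
  · intro hC
    by_contra hcon
    push Not at hcon
    obtain ⟨ht, hn⟩ := hcon
    obtain rfl := hS.trace_eq.resolve_right ht
    have key : ∀ n x y : ZMod 8, 2 * n = 0 → x * x + n * (y * y) ≠ 3 ∧ x * x + n * (y * y) ≠ 7 := by
      decide
    rcases hC with hC | hC | hC
    · exact hS.not_isMaximalOrder hn hC
    · obtain ⟨-, x, y, hxy⟩ := (hS.mem_normGroup_iff _).1 hC
      have := congrArg red hxy
      simp only [normForm, map_add, map_mul, map_ofNat, zero_mul, add_zero] at this
      exact (key _ _ _ hn).1 this.symm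
    · obtain ⟨-, x, y, hxy⟩ := (hS.mem_normGroup_iff _).1 hC
      have := congrArg red hxy
      simp only [normForm, map_add, map_mul, map_ofNat, zero_mul, add_zero] at this
      exact (key _ _ _ hn).2 this.symm
  · intro hC
    rcases hS.trace_eq with rfl | rfl
    · have hn : 2 * red n ≠ 0 := hC.resolve_left zero_ne_one
      by_cases h2 : 2 * red n = 2
      · exact .inl (hS.isMaximalOrder hθ h2)
      -- If `n ≡ 2 mod 4`, then `1 + n` is `3` or `7` modulo `8`; if `n ≡ 3 mod 4`, then `n` itself
      -- is.
      · have key : ∀ n : ZMod 8, 2 * n ≠ 0 → 2 * n ≠ 2 → ∃ x y : ZMod 8,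
            x * x + n * (y * y) = 3 ∨ x * x + n * (y * y) = 7 := by decide
        obtain ⟨x, y, hxy⟩ := key _ hn h2
        obtain ⟨x, rfl⟩ := red_surjective x
        obtain ⟨y, rfl⟩ := red_surjective y
        refine .inr (hxy.imp (fun h => ?_) fun h => ?_)
        · exact hS.mem_normGroup_of_red isUnit_three (x := x) (y := y)
            (by simpa [normForm, map_ofNat] using h)
        · exact hS.mem_normGroup_of_red isUnit_seven (x := x) (y := y)
            (by simpa [normForm, map_ofNat] using h)
    · obtain ⟨x, y, hxy⟩ := exists_norm_mul_eq_one_of_trace_one (red n) 3 (by decide)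
      obtain ⟨x, rfl⟩ := red_surjective x
      obtain ⟨y, rfl⟩ := red_surjective y
      have key : ∀ a : ZMod 8, 3 * a = 1 → a = 3 := by decide
      refine .inr (.inl (hS.mem_normGroup_of_red isUnit_three (x := x) (y := y) ?_))
      simpa [normForm, map_ofNat] using key _ hxy

end Maximal

/-! ### Gauss sums -/

section Gauss

/-- The additive character `c ↦ i ^ c`. -/
def iPow (c : ZMod 8) : GaussianInt := (⟨0, 1⟩ : GaussianInt) ^ c.val

theorem iPow_add : ∀ a b : ZMod 8, iPow (a + b) = iPow a * iPow b := by
  unfold iPow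
  decide

theorem iPow_sum {g : ℕ} (f : Fin g → ZMod 8) : iPow (∑ i, f i) = ∏ i, iPow (f i) := by
  induction g with
  | zero => rfl
  | succ g ih => rw [Fin.sum_univ_succ, Fin.prod_univ_succ, iPow_add, ih]

/-- The value at a vector over `𝔽₂` of the `ℤ/8`-valued form attached to a diagonal lattice. -/
def diagVal {g : ℕ} (a : Fin g → ℤ_[2]) (x : Fin g → ZMod 2) : ZMod 8 :=
  ∑ i, red (a i) * ((x i).val : ZMod 8)

/-- The form is diagonal, so the sum over `𝔽₂^g` factors into one sum over `𝔽₂` per coordinate. -/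
theorem sum_iPow_diagVal {g : ℕ} (a : Fin g → ℤ_[2]) :
    ∑ x : Fin g → ZMod 2, iPow (diagVal a x) = ∏ i, (1 + iPow (red (a i))) := by
  have h1 : ∀ c : ZMod 8, 1 + iPow c = ∑ x : ZMod 2, iPow (c * (x.val : ZMod 8)) := by
    unfold iPow
    decide
  simp_rw [h1, diagVal, iPow_sum]
  rw [Finset.prod_univ_sum, Fintype.piFinset_univ]

variable {d : ℤ} {S : Subalgebra ℤ_[2] (QuadField₂ d)} {n : ℤ_[2]} {θ : QuadField₂ d}

local notation "ι" => algebraMap ℤ_[2] (QuadField₂ d)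

/-- Membership in the ideal of `S` generated by `2` and `θ`. -/
def IsEvenElt (θ z : QuadField₂ d) : Prop :=
  ∃ x y : ℤ_[2], z = algebraMap ℤ_[2] (QuadField₂ d) (2 * x) +
    algebraMap ℤ_[2] (QuadField₂ d) y * θ

theorem IsEvenElt.sum {g : ℕ} {f : Fin g → QuadField₂ d} (hf : ∀ i, IsEvenElt θ (f i)) :
    IsEvenElt θ (∑ i, f i) := by
  choose x y hxy using hf
  refine ⟨∑ i, x i, ∑ i, y i, ?_⟩
  simp_rw [hxy, Finset.mul_sum, map_sum, Finset.sum_mul, Finset.sum_add_distrib]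

theorem IsEvenElt.mul (hS : IsQuadOrder (conj₂ d) S 0 n θ) (hn : 2 * red n = 0)
    {z s : QuadField₂ d} (hz : IsEvenElt θ z) (hs : s ∈ S) : IsEvenElt θ (z * s) := by
  obtain ⟨x, y, rfl⟩ := hz
  obtain ⟨p, q, rfl⟩ := (hS.mem_iff s).1 hs
  obtain ⟨k, rfl⟩ := (two_dvd_iff_red n).2 (by linear_combination 2 * hn)
  refine ⟨x * p - k * y * q, 2 * x * q + y * p, ?_⟩
  have := hS.gen_mul_gen
  simp only [map_mul, map_add, map_sub, map_zero, zero_mul, zero_sub] at this ⊢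
  linear_combination ι y * ι q * this

theorem diagForm_apply {g : ℕ} (a : Fin g → ℤ_[2]) (x y : Fin g → QuadField₂ d) :
    diagForm d a x y = ∑ i, ι (a i) * (x i * conj₂ d (y i)) := rfl

/-- The Gauss sum of a diagonal lattice is an isometry invariant if the norm of the generator is
divisible by `4`. -/
theorem gaussSum_eq_of_isometric (hS : IsQuadOrder (conj₂ d) S 0 n θ) (hn : 2 * red n = 0)
    {g : ℕ} {a a' : Fin g → ℤ_[2]}
    (hiso : Isometric S (diagForm d a) (stdLattice S g) (diagForm d a') (stdLattice S g)) :
    ∏ i, (1 + iPow (red (a i))) = ∏ i, (1 + iPow (red (a' i))) := by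
  obtain ⟨φ, hφ, hφL⟩ := hiso
  have hmem : ∀ x : Fin g → QuadField₂ d, (∀ i, x i ∈ S) → ∀ i, φ x i ∈ S := fun x hx => by
    have : φ x ∈ (stdLattice S g : Set _) := hφL ▸ ⟨x, hx, rfl⟩
    exact this
  have hmem' : ∀ x : Fin g → QuadField₂ d, (∀ i, x i ∈ S) → ∀ i, φ.symm x i ∈ S := fun x hx => by
    have : x ∈ φ '' (stdLattice S g : Set _) := by rw [hφL]; exact hx
    obtain ⟨y, hy, rfl⟩ := this
    rw [φ.symm_apply_apply]
    exact hy
  let lift : (Fin g → ZMod 2) → Fin g → QuadField₂ d := fun x i => ι ((x i).val : ℤ_[2])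
  have hlift : ∀ x i, φ (lift x) i ∈ S := fun x =>
    hmem _ fun i => S.algebraMap_mem _
  choose p q hpq using fun x i => (hS.mem_iff _).1 (hlift x i)
  -- This is the map induced by `φ` on `L/(2, θ)L`: lift to coordinates `0`, `1`, apply `φ`, and
  -- take the parity of the `ℤ₂`-part.
  let T : (Fin g → ZMod 2) → Fin g → ZMod 2 := fun x i => if 4 * red (p x i) = 4 then 1 else 0
  have hTinj : Function.Injective T := by
    intro x y hxy
    have hev : ∀ j, IsEvenElt θ (φ (lift x - lift y) j) := by
      intro j
      have hj : 4 * red (p x j) = 4 ↔ 4 * red (p y j) = 4 := by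
        have := congrFun hxy j
        simp only [T] at this
        split_ifs at this with h1 h2 h2 <;> simp_all
      obtain ⟨k, hk⟩ : ∃ k, p x j - p y j = 2 * k := by
        rw [two_dvd_iff_red, map_sub]
        generalize red (p x j) = r at hj
        generalize red (p y j) = s at hj
        revert r s; decide
      refine ⟨k, q x j - q y j, ?_⟩
      rw [map_sub, Pi.sub_apply, hpq, hpq, ← hk, map_sub, map_sub]
      ring
    -- The inverse isometry has coefficients in `S`, so it too preserves vectors with all
    -- coordinates in `(2, θ)`. The coordinates of `lift x - lift y` are in `ℤ₂`, hence even.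
    have hev' : ∀ i, IsEvenElt θ ((lift x - lift y) i) := by
      intro i
      have hsum : lift x - lift y = ∑ j, φ (lift x - lift y) j • φ.symm (Pi.single j 1) := by
        rw [← φ.symm_apply_apply (lift x - lift y)]
        conv_lhs => rw [pi_eq_sum_univ' (φ (lift x - lift y))]
        rw [map_sum, φ.apply_symm_apply]
        refine Finset.sum_congr rfl fun j _ => ?_
        rw [map_smul]
      rw [hsum, Finset.sum_apply]
      refine IsEvenElt.sum fun j => (hev j).mul hS hn (hmem' _ (fun i => ?_) i)
      by_cases hij : i = j
      · subst hij; rw [Pi.single_eq_same]; exact S.one_mem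
      · rw [Pi.single_eq_of_ne hij]; exact S.zero_mem
    funext i
    obtain ⟨r, s, hrs⟩ := hev' i
    have h1 : ((x i).val : ℤ_[2]) - ((y i).val : ℤ_[2]) = 2 * r := by
      refine (hS.elt_inj (y := 0) (y' := s) ?_).1
      rw [← hrs, map_zero, zero_mul, add_zero, map_sub]
      rfl
    have h2 := congrArg red h1
    rw [map_sub, map_natCast, map_natCast, map_mul, map_ofNat] at h2
    generalize x i = x' at h2
    generalize y i = y' at h2
    generalize red r = r' at h2
    revert x' y' r'; decide
  have hT : Function.Bijective T := hTinj.bijective_of_finite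
  have hval : ∀ x, iPow (diagVal a x) = iPow (diagVal a' (T x)) := by
    intro x
    have h1 := hφ (lift x) (lift x)
    rw [diagForm_apply, diagForm_apply] at h1
    simp_rw [hpq, hS.elt_mul_map] at h1
    have h2 : ∑ i, a' i * normForm 0 n (p x i) (q x i) =
        ∑ i, a i * (((x i).val : ℤ_[2]) * (x i).val) := by
      apply hS.injective
      rw [map_sum, map_sum]
      simp_rw [map_mul]
      rw [h1]
      exact Finset.sum_congr rfl fun i _ => by rw [hS.map_algebraMap]
    have h3 := congrArg red h2
    rw [map_sum, map_sum] at h3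
    have e1 : diagVal a x = ∑ i, red (a i * (((x i).val : ℤ_[2]) * (x i).val)) := by
      refine Finset.sum_congr rfl fun i _ => ?_
      rw [map_mul, map_mul, map_natCast]
      have : ∀ y : ZMod 2, (y.val : ZMod 8) = (y.val : ZMod 8) * y.val := by decide
      rw [← this]
    rw [e1, ← h3, diagVal, iPow_sum, iPow_sum]
    refine Finset.prod_congr rfl fun i _ => ?_
    simp only [T, normForm, map_mul, map_add, zero_mul, add_zero]
    -- As `4 ∣ n`, `p² + nq²` is congruent modulo `4` to the parity of `p`, and `iPow` sees only
    -- residues modulo `4`.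
    have key : ∀ a n p q : ZMod 8, 2 * n = 0 → iPow (a * (p * p + n * (q * q))) =
        iPow (a * (((if 4 * p = 4 then (1 : ZMod 2) else 0).val : ℕ) : ZMod 8)) := by
      intro a n p q hn
      have k1 : ∀ n p q : ZMod 8, 2 * n = 0 → p * p + n * (q * q) =
          (((if 4 * p = 4 then (1 : ZMod 2) else 0).val : ℕ) : ZMod 8) ∨
          p * p + n * (q * q) =
          (((if 4 * p = 4 then (1 : ZMod 2) else 0).val : ℕ) : ZMod 8) + 4 := by decide
      have k2 : ∀ b : ZMod 8, iPow (b * 4) = 1 := by unfold iPow; decide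
      rcases k1 n p q hn with h | h
      · rw [h]
      · rw [h, mul_add, iPow_add, k2, mul_one]
    exact key _ _ _ _ hn
  rw [← sum_iPow_diagVal, ← sum_iPow_diagVal]
  exact (Finset.sum_congr rfl fun x _ => hval x).trans
    (Equiv.sum_comp (Equiv.ofBijective T hT) fun y => iPow (diagVal a' y))

end Gauss

/-! ### Bases, determinants and isometries -/

section Basis

variable {d : ℤ} {S : Subalgebra ℤ_[2] (QuadField₂ d)} {t n : ℤ_[2]} {θ : QuadField₂ d}
  {V : Type*} [AddCommGroup V] [Module (QuadField₂ d) V] {h : SesqForm d V} {L : Submodule S V}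
  {g : ℕ}

local notation "ι" => algebraMap ℤ_[2] (QuadField₂ d)

theorem HasOrth.exists_family {K : Type*} [CommRing K] [Algebra ℤ_[2] K] {σ : K →+* K}
    {S : Subalgebra ℤ_[2] K} {V : Type*} [AddCommGroup V] [Module K V] {h : V →ₗ[K] V →ₛₗ[σ] K}
    {L : Submodule S V} (hh : ∀ v w, h v w = σ (h w v)) {a : Fin g → ℤ_[2]}
    (hl : HasOrth S h L (List.ofFn a)) :
    ∃ v : Fin g → V, (∀ i, h (v i) (v i) = algebraMap ℤ_[2] K (a i)) ∧
      (∀ i j, i ≠ j → h (v i) (v j) = 0) ∧ Submodule.span S (Set.range v) = L := by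
  obtain ⟨vs, h1, h2, h3⟩ := hl
  have hlen : vs.length = g := by rw [← h1.length_eq, List.length_ofFn]
  subst hlen
  refine ⟨fun i => vs.get i, fun i => ?_, fun i j hij => ?_, ?_⟩
  · have := (List.forall₂_iff_get.1 h1).2 i (by simp) i.2
    simpa using this
  · rw [List.pairwise_iff_get] at h2
    rcases lt_or_gt_of_ne hij with hlt | hlt
    · exact h2 i j hlt
    · rw [hh, h2 j i hlt, map_zero]
  · rw [← h3]
    congr 1
    ext v
    simp [List.mem_iff_get]

theorem coeff_eq_zero_of_orth {a : Fin g → ℤ_[2]} (ha : ∀ i, IsUnit (a i)) {v : Fin g → V}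
    (h1 : ∀ i, h (v i) (v i) = ι (a i)) (h2 : ∀ i j, i ≠ j → h (v i) (v j) = 0)
    {c : Fin g → QuadField₂ d} (hc : ∑ i, c i • v i = 0) (j : Fin g) : c j = 0 := by
  have h3 : h (∑ i, c i • v i) (v j) = c j * ι (a j) := by
    rw [map_sum, LinearMap.sum_apply, Finset.sum_eq_single j]
    · rw [map_smul, LinearMap.smul_apply, h1, smul_eq_mul]
    · intro i _ hij
      rw [map_smul, LinearMap.smul_apply, h2 i j hij, smul_zero]
    · intro hj; exact absurd (Finset.mem_univ j) hj
  obtain ⟨e, he⟩ := (ha j).exists_right_inv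
  have he' : ι (a j) * ι e = 1 := by rw [← map_mul, he, map_one]
  rw [hc, map_zero, LinearMap.zero_apply] at h3
  linear_combination (-c j) * he' - ι e * h3

/-- Unit lengths make the orthogonal vectors independent over `F₂`, and fullness of `L` makes them
span `V`; the coordinate map is the isometry. -/
theorem HasOrth.isometricToDiag (hh : ∀ v w, h v w = conj₂ d (h w v))
    (hL : IsFullLattice S L) {a : Fin g → ℤ_[2]} (ha : ∀ i, IsUnit (a i))
    (hl : HasOrth S h L (List.ofFn a)) : IsometricToDiag S h L a := by
  obtain ⟨v, h1, h2, h3⟩ := hl.exists_family hh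
  have hli : LinearIndependent (QuadField₂ d) v := by
    rw [Fintype.linearIndependent_iff]
    exact fun c hc => coeff_eq_zero_of_orth ha h1 h2 hc
  have hsp : ⊤ ≤ Submodule.span (QuadField₂ d) (Set.range v) := by
    rw [← hL.full, Submodule.span_le]
    intro x hx
    rw [← h3] at hx
    exact Submodule.span_le_restrictScalars S (QuadField₂ d) (Set.range v) hx
  let B := Module.Basis.mk hli hsp
  have hB : ∀ i, B i = v i := fun i => Module.Basis.mk_apply hli hsp i
  refine ⟨B.equivFun, fun x y => ?_, ?_⟩
  · have hx := B.sum_equivFun x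
    have hy := B.sum_equivFun y
    rw [diagForm_apply]
    conv_rhs => rw [← hx, ← hy]
    rw [map_sum]
    refine Finset.sum_congr rfl fun i _ => ?_
    rw [LinearMap.map_smulₛₗ, map_sum, LinearMap.sum_apply, Finset.sum_eq_single i]
    · rw [map_smul, LinearMap.smul_apply, hB, h1, smul_eq_mul, smul_eq_mul]
      ring
    · intro j _ hij
      rw [map_smul, LinearMap.smul_apply, hB, hB, h2 j i hij, smul_zero]
    · intro hi; exact absurd (Finset.mem_univ i) hi
  · ext x
    constructor
    · rintro ⟨y, hy, rfl⟩ i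
      rw [SetLike.mem_coe, ← h3] at hy
      induction hy using Submodule.span_induction with
      | zero => rw [map_zero]; exact S.zero_mem
      | add x y _ _ hx hy => rw [map_add]; exact S.add_mem hx hy
      | smul s x _ hx =>
        rw [Subalgebra.smul_def, map_smul, Pi.smul_apply, smul_eq_mul]
        exact S.mul_mem s.2 hx
      | mem x hx =>
        obtain ⟨j, rfl⟩ := hx
        rw [← hB, Module.Basis.equivFun_self]
        split_ifs
        exacts [S.one_mem, S.zero_mem]
    · intro hx
      refine ⟨∑ i, x i • v i, ?_, ?_⟩
      · rw [SetLike.mem_coe, ← h3]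
        exact Submodule.sum_mem _ fun i _ =>
          smul_coe_mem (hx i) (Submodule.subset_span ⟨i, rfl⟩)
      · simp_rw [← hB]
        rw [← Module.Basis.equivFun_symm_apply, LinearEquiv.apply_symm_apply]

theorem span_range_coe_basis (b : Module.Basis (Fin g) S L) :
    Submodule.span S (Set.range fun i => (b i : V)) = L := by
  have : (Set.range fun i => (b i : V)) = L.subtype '' Set.range b := by
    rw [← Set.range_comp]; rfl
  rw [this, Submodule.span_image, b.span_eq, Submodule.map_top, Submodule.range_subtype]

/-- A basis of a lattice with unit determinant is a unimodular family. -/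
theorem isUnimodularFamily_of_basis (hS : IsQuadOrder (conj₂ d) S t n θ)
    (huni : IsUnimodular S h L) (b : Module.Basis (Fin g) S L) {c : ℤ_[2]}
    (hc : (gram h fun i => (b i : V)).det * ι c = 1) :
    IsUnimodularFamily S h fun i => (b i : V) := by
  have hint : ∀ i j, h (b i : V) (b j : V) ∈ S := by
    intro i j
    have hi : (b i : V) ∈ dualLattice S h L := huni ▸ (b i).2
    exact hi _ (b j).2
  refine ⟨hint, fun f hf => ?_⟩
  let G : Matrix (Fin g) (Fin g) S := Matrix.of fun i j => ⟨_, hint i j⟩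
  let F : Fin g → S := fun i => ⟨f i, hf i⟩
  have hG : gram h (fun i => (b i : V)) = G.map S.val := by ext i j; rfl
  have hdet : IsUnit G.det := by
    refine IsUnit.of_mul_eq_one (⟨ι c, S.algebraMap_mem c⟩ : S) ?_
    apply Subtype.ext
    rw [S.coe_mul, S.coe_one, ← hc, hG]
    congr 1
    exact RingHom.map_det (S.val : S →+* QuadField₂ d) G
  let y : Fin g → S := G⁻¹.mulVec F
  have hy : G.mulVec y = F := by
    rw [Matrix.mulVec_mulVec, Matrix.mul_nonsing_inv _ hdet, Matrix.one_mulVec]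
  -- The coefficients solve the linear system with the Gram matrix; they are conjugated because they
  -- enter the second variable.
  refine ⟨∑ i, conj₂ d (y i) • (b i : V), Submodule.sum_mem _ fun i _ =>
    smul_coe_mem (hS.map_mem (y i).2) (Submodule.subset_span ⟨i, rfl⟩), fun j => ?_⟩
  have hj := congrArg (fun r : S => (r : QuadField₂ d)) (congrFun hy j)
  rw [map_sum]
  simp_rw [LinearMap.map_smulₛₗ, hS.map_map (y _).2]
  refine Eq.trans ?_ hj
  simp only [Matrix.mulVec, dotProduct, AddSubmonoidClass.coe_finsetSum, S.coe_mul]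
  exact Finset.sum_congr rfl fun i _ => mul_comm _ _

end Basis

/-! ### Determinant of an orthogonal basis -/

section Determinant

variable {K : Type*} [CommRing K] [Algebra ℤ_[2] K] {σ : K →+* K}
  {S : Subalgebra ℤ_[2] K} {V : Type*} [AddCommGroup V] [Module K V]
  {h : V →ₗ[K] V →ₛₗ[σ] K} {L : Submodule S V} {g : ℕ}

local notation "ι" => algebraMap ℤ_[2] K

/-- The product of the lengths of an orthogonal basis is the determinant up to norms of units. -/
theorem HasOrth.det_eq
    (hh : ∀ v w, h v w = σ (h w v)) (b : Module.Basis (Fin g) S L)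
    {a : Fin g → ℤ_[2]} (hl : HasOrth S h L (List.ofFn a)) :
    ∃ p ∈ S, ∃ q ∈ S, p * q = 1 ∧
      ι (∏ i, a i) * (p * σ p) = (Matrix.of fun i j => h (b i : V) (b j : V)).det := by
  obtain ⟨v, h1, h2, h3⟩ := hl.exists_family hh
  have hbmem : ∀ i, ∃ P : Fin g → S, ∑ j, P j • v j = (b i : V) := fun i => by
    rw [← Submodule.mem_span_range_iff_exists_fun, h3]
    exact (b i).2
  have hvL : ∀ i, v i ∈ L := fun i => h3 ▸ Submodule.subset_span ⟨i, rfl⟩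
  choose P hP using hbmem
  let Q : Matrix (Fin g) (Fin g) S := Matrix.of fun i j => b.repr ⟨v i, hvL i⟩ j
  have hPQ : Matrix.of P * Q = 1 := by
    ext i k
    congr 1
    have hbi : b i = ∑ j, P i j • (⟨v j, hvL j⟩ : L) := by
      apply Subtype.ext
      rw [AddSubmonoidClass.coe_finsetSum, ← hP i]
      rfl
    have := congrArg (fun x => b.repr x k) hbi
    simp only [b.repr_self, map_sum, map_smul, Finsupp.finsetSum_apply, Finsupp.smul_apply,
      smul_eq_mul] at this
    rw [Matrix.mul_apply, Matrix.one_apply, ← Finsupp.single_apply, this]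
    rfl
  -- The Gram matrix is `P · diag(a) · σ(P)ᵀ`, so its determinant is `∏ aᵢ` times the norm of the
  -- unit `det P`.
  have hgram : (Matrix.of fun i j => h (b i : V) (b j : V)) = (Matrix.of P).map S.val *
      Matrix.diagonal (fun i => ι (a i)) * (((Matrix.of P).map S.val).map σ).transpose := by
    ext i k
    rw [Matrix.mul_apply]
    simp only [Matrix.mul_diagonal, Matrix.map_apply, Matrix.transpose_apply, Matrix.of_apply,
      ← hP, map_sum, LinearMap.sum_apply, Subalgebra.smul_def, map_smul,
      LinearMap.smul_apply, LinearMap.map_smulₛₗ]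
    refine Finset.sum_congr rfl fun j _ => ?_
    rw [Finset.sum_eq_single j]
    · rw [h1, smul_eq_mul, smul_eq_mul]
      simp only [Subalgebra.coe_val]
      ring
    · intro l _ hl
      rw [h2 l j hl, smul_zero]
    · intro hj; exact absurd (Finset.mem_univ j) hj
  have hdet : (Matrix.of P).det * Q.det = 1 := by
    rw [← Matrix.det_mul, hPQ, Matrix.det_one]
  refine ⟨_, (Matrix.of P).det.2, _, Q.det.2, ?_, ?_⟩
  · rw [← S.coe_mul, hdet, S.coe_one]
  · have e1 : ((Matrix.of P).map S.val).det = ((Matrix.of P).det : K) :=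
      (RingHom.map_det (S.val : S →+* K) (Matrix.of P)).symm
    have e2 : (((Matrix.of P).map S.val).map σ).det = σ ((Matrix.of P).det : K) := by
      rw [← e1]
      exact (RingHom.map_det σ _).symm
    rw [hgram, Matrix.det_mul, Matrix.det_mul, Matrix.det_transpose, e1, e2, Matrix.det_diagonal,
      map_prod]
    ring

end Determinant

/-! ### The classification -/

theorem ofFn_onesThen (k : ℕ) (u : ℤ_[2]) :
    List.ofFn (onesThen (k + 1) u) = List.replicate k 1 ++ [u] := by
  apply List.ext_getElem
  · simp
  · intro i h1 h2
    rw [List.getElem_ofFn, List.getElem_append]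
    simp only [List.length_ofFn] at h1
    by_cases hi : i = k
    · subst hi; simp [onesThen]
    · have : i < k := by omega
      simp [onesThen, hi, this]

theorem ofFn_onesThenThrees (k : ℕ) (u : ℤ_[2]) :
    List.ofFn (onesThenThrees (k + 3) u) = List.replicate k 1 ++ [3, 3, u] := by
  apply List.ext_getElem
  · simp
  · intro i h1 h2
    rw [List.getElem_ofFn, List.getElem_append]
    simp only [List.length_ofFn] at h1
    by_cases hi : i < k
    · have h4 : ¬ k ≤ i := by omega
      simp [onesThenThrees, hi, h4]
      omega
    · obtain ⟨j, rfl⟩ := Nat.exists_eq_add_of_le (not_lt.1 hi)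
      have hj : j < 3 := by omega
      interval_cases j <;> simp [onesThenThrees]

theorem isUnit_onesThen (g : ℕ) {u : ℤ_[2]} (hu : IsUnit u) (i : Fin g) :
    IsUnit (onesThen g u i) := by
  unfold onesThen
  split_ifs
  exacts [hu, isUnit_one]

theorem isUnit_onesThenThrees (g : ℕ) {u : ℤ_[2]} (hu : IsUnit u) (i : Fin g) :
    IsUnit (onesThenThrees g u i) := by
  unfold onesThenThrees
  split_ifs
  exacts [hu, isUnit_three, isUnit_one]

/-- For odd `c` the value is `1 ± i`; this allows common factors of two Gauss sums to be cancelled.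
-/
theorem one_add_iPow_ne_zero : ∀ c : ZMod 8, 4 * c = 4 → 1 + iPow c ≠ 0 := by
  unfold iPow
  decide

/-! ### Distinguishing the normal forms -/

section Exclusion

variable {d : ℤ} {S : Subalgebra ℤ_[2] (QuadField₂ d)} {n : ℤ_[2]} {θ : QuadField₂ d}
  {V : Type*} [AddCommGroup V] [Module (QuadField₂ d) V] {h : SesqForm d V} {L : Submodule S V}

theorem IsometricToDiag.isometric {g : ℕ} {a a' : Fin g → ℤ_[2]} (ha : IsometricToDiag S h L a)
    (ha' : IsometricToDiag S h L a') :
    Isometric S (diagForm d a) (stdLattice S g) (diagForm d a') (stdLattice S g) := by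
  obtain ⟨φ, hφ, hφL⟩ := ha
  obtain ⟨ψ, hψ, hψL⟩ := ha'
  refine ⟨φ.symm.trans ψ, fun v w => ?_, ?_⟩
  · rw [LinearEquiv.trans_apply, LinearEquiv.trans_apply, hψ, ← hφ, φ.apply_symm_apply,
      φ.apply_symm_apply]
  · conv_rhs => rw [← hψL]
    rw [← hφL, Set.image_image]
    refine Set.image_congr fun x _ => ?_
    rw [LinearEquiv.trans_apply, φ.symm_apply_apply]

theorem gaussList_eq (hS : IsQuadOrder (conj₂ d) S 0 n θ) (hn : 2 * red n = 0) {g : ℕ}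
    {a a' : Fin g → ℤ_[2]} (ha : IsometricToDiag S h L a) (ha' : IsometricToDiag S h L a') :
    ((List.ofFn a).map fun c => 1 + iPow (red c)).prod =
      ((List.ofFn a').map fun c => 1 + iPow (red c)).prod := by
  rw [List.map_ofFn, List.map_ofFn, List.prod_ofFn, List.prod_ofFn]
  exact gaussSum_eq_of_isometric hS hn (ha.isometric ha')

/-- After cancelling the common factors the Gauss sums are `(1 + i)² = 2i` and `(1 - i)² = -2i`. -/
theorem not_onesThen_and_onesThenThrees (hS : IsQuadOrder (conj₂ d) S 0 n θ)
    (hn : 2 * red n = 0) {k : ℕ} {u : ℤ_[2]} (hu : IsUnit u)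
    (ha : IsometricToDiag S h L (onesThen (k + 3) u))
    (ha' : IsometricToDiag S h L (onesThenThrees (k + 3) u)) : False := by
  have h1 := gaussList_eq hS hn ha ha'
  rw [ofFn_onesThen, ofFn_onesThenThrees] at h1
  have hne := one_add_iPow_ne_zero _ ((isUnit_iff_red u).1 hu)
  have hne1 := one_add_iPow_ne_zero 1 (by decide)
  simp only [List.map_append, List.map_replicate, List.map_cons, List.map_nil, List.prod_append,
    List.prod_replicate, List.prod_cons, List.prod_nil, mul_one, map_one, map_ofNat] at h1
  rw [pow_add, mul_assoc] at h1
  have h2 := mul_left_cancel₀ (pow_ne_zero k hne1) h1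
  rw [← mul_assoc] at h2
  have h3 := mul_right_cancel₀ hne h2
  revert h3
  unfold iPow
  decide

/-- Here `u ≡ 1` and `3u ≡ 3` modulo `4`, so the Gauss sums are again `2i` and `-2i`. -/
theorem not_onesThen_and_three_three (hS : IsQuadOrder (conj₂ d) S 0 n θ)
    (hn : 2 * red n = 0) {u : ℤ_[2]} (hu : 2 * red u = 2)
    (ha : IsometricToDiag S h L (onesThen 2 u))
    (ha' : IsometricToDiag S h L (![3, 3 * u] : Fin 2 → ℤ_[2])) : False := by
  have h1 := gaussList_eq hS hn ha ha'
  rw [ofFn_onesThen] at h1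
  have key : ∀ c : ZMod 8, 2 * c = 2 →
      (1 + iPow 1) * (1 + iPow c) ≠ (1 + iPow 3) * (1 + iPow (3 * c)) := by
    unfold iPow
    decide
  exact key _ hu (by simpa [map_ofNat, List.ofFn_succ] using h1)

end Exclusion

/-! ### Fixing the last length by the determinant -/

section Finish

variable {d : ℤ} {S : Subalgebra ℤ_[2] (QuadField₂ d)} {t n : ℤ_[2]} {θ : QuadField₂ d}
  {V : Type*} [AddCommGroup V] [Module (QuadField₂ d) V] {h : SesqForm d V} {L : Submodule S V}

local notation "ι" => algebraMap ℤ_[2] (QuadField₂ d)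

/-- The product of the lengths of an orthogonal basis represents the determinant class. -/
theorem HasOrth.det_class {g : ℕ} (hh : ∀ v w, h v w = conj₂ d (h w v))
    (b : Module.Basis (Fin g) S L) {u : ℤ_[2]}
    (hu : ∃ n ∈ normGroup S, ι u = (gram h (fun i => (b i : V))).det * ι n)
    {l : List ℤ_[2]} (hlen : l.length = g) (hl : HasOrth S h L l) :
    ∃ p ∈ S, ∃ q ∈ S, p * q = 1 ∧ ι l.prod * (p * conj₂ d p) = ι u := by
  subst hlen
  obtain ⟨p, hp, q, hq, hpq, hdet⟩ := HasOrth.det_eq (a := l.get) hh b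
    (by rw [List.ofFn_get]; exact hl)
  obtain ⟨c, ⟨s, hs⟩, hc⟩ := hu
  have hss : ((s : S) : QuadField₂ d) * ((s⁻¹ : Sˣ) : S) = 1 := by
    rw [← S.coe_mul, Units.mul_inv, S.coe_one]
  rw [← List.prod_ofFn, List.ofFn_get] at hdet
  refine ⟨p * (s : S), S.mul_mem hp (s : S).2, q * ((s⁻¹ : Sˣ) : S),
    S.mul_mem hq ((s⁻¹ : Sˣ) : S).2, ?_, ?_⟩
  · rw [mul_mul_mul_comm, hpq, hss, one_mul]
  · have hd : (gram h (fun i => (b i : V))).det = ι l.prod * (p * conj₂ d p) := hdet.symm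
    rw [hc, hd, hs, map_mul]
    ring

/-- Adjusting the first length of an orthogonal basis by means of the determinant. -/
theorem HasOrth.adjust_det {g : ℕ} (hh : ∀ v w, h v w = conj₂ d (h w v))
    (hS : IsQuadOrder (conj₂ d) S t n θ) (b : Module.Basis (Fin g) S L) {u : ℤ_[2]}
    (hu : ∃ n ∈ normGroup S, ι u = (gram h (fun i => (b i : V))).det * ι n)
    {w : ℤ_[2]} {r : List ℤ_[2]} (hl : HasOrth S h L (w :: r)) (hlen : r.length + 1 = g)
    {k m : ℤ_[2]} (hm : IsUnit m) (hk : r.prod * k = m * m) :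
    HasOrth S h L (u * k :: r) := by
  obtain ⟨p, hp, q, hq, hpq, hdet⟩ := hl.det_class hh b hu (by rw [List.length_cons, hlen])
  obtain ⟨e, he⟩ := hm.exists_right_inv
  -- From `w · r.prod · N(p) = u` and `r.prod · k = m²` one gets `w · N(mp) = u k`.
  refine hl.scale (p := ι m * p) (q := ι e * q)
    (S.mul_mem (S.algebraMap_mem m) hp) (S.mul_mem (S.algebraMap_mem e) hq) ?_ ?_
  · rw [mul_mul_mul_comm, hpq, ← map_mul, he, map_one, one_mul]
  · have hk' : ι r.prod * ι k = ι m * ι m := by rw [← map_mul, hk, map_mul]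
    rw [map_mul ι u, ← hdet, List.prod_cons, map_mul ι w, map_mul, hS.map_algebraMap]
    linear_combination (-ι w * p * conj₂ d p) * hk'

end Finish

/-- The classification of odd unimodular lattices over a quadratic order. -/
theorem IsQuadOrder.classification {d : ℤ} {S : Subalgebra ℤ_[2] (QuadField₂ d)} {t n : ℤ_[2]}
    {θ : QuadField d} (hθ : θ.im ≠ 0)
    (hS : IsQuadOrder (conj₂ d) S t n ((1 : ℚ_[2]) ⊗ₜ[ℚ] θ))
    {V : Type*} [AddCommGroup V] [Module (QuadField₂ d) V]
    (h : SesqForm d V) (hV : IsHermitianSpace h)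
    (L : Submodule S V) (hL : IsFullLattice S L)
    (g : ℕ) (hg : 2 ≤ g) (b : Module.Basis (Fin g) S L)
    (huni : IsUnimodular S h L)
    (hodd : ¬ IsEvenLattice S h L)
    (u : ℤ_[2]ˣ)
    (hu : ∃ n ∈ normGroup S,
      algebraMap ℤ_[2] (QuadField₂ d) u =
        (gram h (fun i => (b i : V))).det * algebraMap ℤ_[2] (QuadField₂ d) n) :
    ((IsMaximalOrder S ∨ 3 ∈ normGroup S ∨
        7 ∈ normGroup S) →
      IsometricToDiag S h L (onesThen g u)) ∧
    (¬ (IsMaximalOrder S ∨ 3 ∈ normGroup S ∨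
        7 ∈ normGroup S) →
      (2 < g →
        Xor (IsometricToDiag S h L (onesThen g u))
          (IsometricToDiag S h L (onesThenThrees g u))) ∧
      (g = 2 →
        Xor (IsometricToDiag S h L (onesThen g u))
          ((∃ n ∈ normGroup S, (u : ℤ_[2]) = n ∨ (u : ℤ_[2]) = 5 * n) ∧
            IsometricToDiag S h L (![3, 3 * u] : Fin 2 → ℤ_[2])))) := by
  rw [hS.condition_iff hθ]
  have hh := hV.hermitian
  -- an orthogonal basis
  have hfam : IsUnimodularFamily S h fun i => (b i : V) := by
    obtain ⟨c, hc, hcu⟩ := hu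
    refine isUnimodularFamily_of_basis hS huni b (c := c * ((u⁻¹ : ℤ_[2]ˣ) : ℤ_[2])) ?_
    rw [map_mul, ← mul_assoc, ← hcu, ← map_mul, Units.mul_inv, map_one]
  have hspan := span_range_coe_basis b
  obtain ⟨l, hlen, hlu, hl⟩ := IsUnimodularFamily.exists_hasOrth hS hh g _ hfam (by
    right
    rw [hspan]
    unfold IsEvenLattice at hodd
    push Not at hodd
    obtain ⟨x, hx, hx'⟩ := hodd
    obtain ⟨a, ha⟩ := hfam.exists_length hS hh (v := x) (hspan.symm ▸ hx)
    refine ⟨x, hx, a, (isUnit_or_two_dvd a).resolve_right ?_, ha⟩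
    rintro ⟨c, rfl⟩
    exact hx' c ha)
  rw [hspan] at hl
  obtain ⟨a, l, rfl⟩ : ∃ a l', l = a :: l' := List.exists_cons_of_ne_nil (by
    rintro rfl
    simp at hlen
    omega)
  rw [List.length_cons] at hlen
  obtain ⟨hau, hlu⟩ := List.forall_mem_cons.1 hlu
  have ones : ∀ w, HasOrth S h L (w :: List.replicate l.length 1) →
      IsometricToDiag S h L (onesThen g u) := by
    intro w hw
    have h1 := hw.adjust_det hh hS b hu (k := 1) (m := 1) (by simpa using hlen) isUnit_one
      (by simp)
    rw [mul_one] at h1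
    refine HasOrth.isometricToDiag hh hL (isUnit_onesThen g u.isUnit) (h1.perm hh ?_)
    subst hlen
    rw [ofFn_onesThen]
    exact (List.perm_append_singleton _ _).symm
  refine ⟨fun hC => ?_, fun hC => ⟨fun hg3 => ?_, fun hg2 => ?_⟩⟩
  · obtain ⟨w, hw⟩ := HasOrth.ones_of_trace_or_norm hS hh hC l a 0 hau hlu (by simpa using hl)
    exact ones w hw
  all_goals
    push Not at hC
    obtain ⟨ht, hn⟩ := hC
    obtain rfl := hS.trace_eq.resolve_right ht
  · obtain ⟨k, rfl⟩ : ∃ k, g = k + 3 := ⟨g - 3, by omega⟩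
    obtain ⟨w, i, j, hw, hij, hl'⟩ :=
      HasOrth.ones_threes hS hh l a 0 0 hau hlu (by simpa using hl)
    obtain ⟨w', hw' | hw'⟩ := HasOrth.normal_form hS hh i w j hw (by omega) hl'
    · have h1 := ones w' (by rwa [show l.length = i + j by omega])
      exact .inl ⟨h1, not_onesThen_and_onesThenThrees hS hn u.isUnit h1⟩
    · rw [show i + j - 2 = k by omega] at hw'
      -- The other lengths have product `3 · 3`, already a square, so the remaining one becomes `u`.
      have h1 := hw'.adjust_det hh hS b hu (k := 1) (m := 3) (by simp) isUnit_three
        (by simp)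
      rw [mul_one] at h1
      have h2 : IsometricToDiag S h L (onesThenThrees (k + 3) u) := by
        refine HasOrth.isometricToDiag hh hL (isUnit_onesThenThrees _ u.isUnit) (h1.perm hh ?_)
        rw [ofFn_onesThenThrees, ← Multiset.coe_eq_coe]
        simp only [← Multiset.coe_add, ← Multiset.cons_coe, ← Multiset.singleton_add,
          Multiset.coe_nil]
        abel
      exact .inr ⟨h2, fun h3 => not_onesThen_and_onesThenThrees hS hn u.isUnit h3 h2⟩
  · subst hg2
    obtain ⟨c, rfl⟩ : ∃ c, l = [c] := List.length_eq_one_iff.1 (by omega)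
    have hcu : IsUnit c := hlu c (by simp)
    have h12 : 2 * red (1 : ℤ_[2]) = 2 := by rw [map_one]; decide
    have h36 : 2 * red (3 : ℤ_[2]) = 6 := by rw [map_ofNat]; decide
    have hsq4 : ∀ m ∈ normGroup S, 2 * red m = 2 := by
      intro m hm
      obtain ⟨hmu, x, y, hxy⟩ := (hS.mem_normGroup_iff m).1 hm
      rw [isUnit_iff_red] at hmu
      have h1 := congrArg red hxy
      simp only [normForm, map_add, map_mul, zero_mul, add_zero] at h1
      have key : ∀ n x y : ZMod 8, 2 * n = 0 → 4 * (x * x + n * (y * y)) = 4 →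
          2 * (x * x + n * (y * y)) = 2 := by decide
      rw [h1] at hmu ⊢
      exact key _ _ _ hn hmu
    have excl : (∃ m ∈ normGroup S, (u : ℤ_[2]) = m ∨ (u : ℤ_[2]) = 5 * m) →
        IsometricToDiag S h L (onesThen 2 u) →
        ¬ IsometricToDiag S h L (![3, 3 * u] : Fin 2 → ℤ_[2]) := by
      rintro ⟨m, hm, hum⟩ h1 h2
      refine not_onesThen_and_three_three hS hn ?_ h1 h2
      have h3 := hsq4 m hm
      rcases hum with h4 | h4
      · rw [h4, h3]
      · rw [h4, map_mul, map_ofNat]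
        generalize red m = r at h3
        revert r; decide
    -- A length that is `1` modulo `4` can be turned into `1`; the determinant then forces the other
    -- to be `u`.
    have first : 2 * red a = 2 ∨ 2 * red c = 2 → IsometricToDiag S h L (onesThen 2 u) := by
      rintro (h2 | h2)
      · exact ones _ ((hl.binary_of_two_mul hS hh isUnit_one hcu (h2.trans h12.symm)).perm hh
          (List.Perm.swap _ _ _))
      · exact ones _ (((hl.perm hh (List.Perm.swap _ _ _)).binary_of_two_mul hS hh isUnit_one hau
          (h2.trans h12.symm)).perm hh (List.Perm.swap _ _ _))
    by_cases hac : 2 * red a = 2 ∨ 2 * red c = 2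
    · exact .inl ⟨first hac, fun h2 => excl h2.1 (first hac) h2.2⟩
    · push Not at hac
      have ha3 := (red_two_mul_of_isUnit hau).resolve_left hac.1
      have hc3 := (red_two_mul_of_isUnit hcu).resolve_left hac.2
      have h1 := (hl.binary_of_two_mul hS hh isUnit_three hcu (ha3.trans h36.symm)).perm hh
        (List.Perm.swap _ _ _)
      have h2 := h1.adjust_det hh hS b hu (k := 3) (m := 3) (by simp) isUnit_three (by simp)
      have h3 : IsometricToDiag S h L (![3, 3 * u] : Fin 2 → ℤ_[2]) := by
        refine HasOrth.isometricToDiag hh hL ?_ (h2.perm hh ?_)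
        · intro i
          fin_cases i
          exacts [isUnit_three, isUnit_three.mul u.isUnit]
        · rw [mul_comm]
          simpa [List.ofFn_succ] using List.Perm.swap _ _ _
      -- Both lengths are `3` modulo `4` and unit norms are `1` modulo `4`, so `u ≡ 1 mod 4`. Hence
      -- `u` or `u/5` is `1` modulo `8`, a square of a unit and therefore a norm.
      have hexu : ∃ m ∈ normGroup S, (u : ℤ_[2]) = m ∨ (u : ℤ_[2]) = 5 * m := by
        obtain ⟨p, hp, q, hq, hpq, hdet⟩ := hl.det_class hh b hu rfl
        obtain ⟨x, y, rfl⟩ := (hS.mem_iff p).1 hp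
        rw [hS.elt_mul_map, ← map_mul] at hdet
        have hdet' := hS.injective hdet
        have hN := hsq4 _ ((hS.mem_normGroup_iff (normForm 0 n x y)).2
          ⟨isUnit_of_mul_isUnit_right (hdet' ▸ u.isUnit), x, y, rfl⟩)
        have hred := congrArg red hdet'
        rw [List.prod_cons, List.prod_singleton, map_mul, map_mul] at hred
        have hu2 : 2 * red (u : ℤ_[2]) = 2 := by
          rw [← hred]
          have key : ∀ a c m : ZMod 8, 2 * a = 6 → 2 * c = 6 → 2 * m = 2 →
              2 * (a * c * m) = 2 := by decide
          exact key _ _ _ ha3 hc3 hN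
        have key : ∀ c : ZMod 8, 2 * c = 2 → c = 1 ∨ c = 5 := by decide
        rcases key _ hu2 with h5 | h5
        · refine ⟨u, hS.mem_normGroup_of_red u.isUnit (x := 1) (y := 0) ?_, .inl rfl⟩
          simp [normForm, h5]
        · have hu5 : IsUnit (5 : ℤ_[2]) := by rw [isUnit_iff_red, map_ofNat]; decide
          obtain ⟨e, he⟩ := hu5.exists_right_inv
          have he' := congrArg red he
          rw [map_mul, map_ofNat, map_one] at he'
          refine ⟨u * e, hS.mem_normGroup_of_red (u.isUnit.mul (IsUnit.of_mul_eq_one_right _ he))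
            (x := 1) (y := 0) ?_, .inr ?_⟩
          · simp [normForm, h5, he']
          · linear_combination (-(u : ℤ_[2])) * he
      exact .inr ⟨⟨hexu, h3⟩, fun h4 => excl hexu h4 h3⟩

end HermLat

end

open HermLat in
theorem mainTheorem9 (d : ℤ) (hd : d < 0) (hsq : Squarefree d)
    (R : Subring (QuadField d)) (hR : IsOrder R)
    {V : Type*} [AddCommGroup V] [Module (QuadField₂ d) V]
    (h : SesqForm d V) (hV : IsHermitianSpace h)
    (L : Submodule (completion₂ R) V) (hL : IsFullLattice (completion₂ R) L)
    (g : ℕ) (hg : 2 ≤ g) (b : Module.Basis (Fin g) (completion₂ R) L)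
    (huni : IsUnimodular (completion₂ R) h L)
    (hodd : ¬ IsEvenLattice (completion₂ R) h L)
    (u : ℤ_[2]ˣ)
    (hu : ∃ n ∈ normGroup (completion₂ R),
      algebraMap ℤ_[2] (QuadField₂ d) u =
        (gram h (fun i => (b i : V))).det * algebraMap ℤ_[2] (QuadField₂ d) n) :
    ((IsMaximalOrder (completion₂ R) ∨ 3 ∈ normGroup (completion₂ R) ∨
        7 ∈ normGroup (completion₂ R)) →
      IsometricToDiag (completion₂ R) h L (onesThen g u)) ∧
    (¬ (IsMaximalOrder (completion₂ R) ∨ 3 ∈ normGroup (completion₂ R) ∨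
        7 ∈ normGroup (completion₂ R)) →
      (2 < g →
        Xor (IsometricToDiag (completion₂ R) h L (onesThen g u))
          (IsometricToDiag (completion₂ R) h L (onesThenThrees g u))) ∧
      (g = 2 →
        Xor (IsometricToDiag (completion₂ R) h L (onesThen g u))
          ((∃ n ∈ normGroup (completion₂ R), (u : ℤ_[2]) = n ∨ (u : ℤ_[2]) = 5 * n) ∧
            IsometricToDiag (completion₂ R) h L (![3, 3 * u] : Fin 2 → ℤ_[2])))) := by
  obtain ⟨θ, t, n, hθ, hS⟩ := hR.exists_isQuadOrder
  exact hS.classification hθ h hV L hL g hg b huni hodd u hu
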